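/- **Riemann's bilinear relations for holomorphic $1$-cochains.** *Setting.* Let $g\ge 1$, let $M$ be the closed oriented surface of genus $g$ obtained from a $4g$-gon with counterclockwise sides $a_1,b_1,a_1^{-1},b_1^{-1},\dots,a_g,b_g,a_g^{-1},b_g^{-1}$ by identifying $a_i$ with $a_i^{-1}$ and $b_i$ with $b_i^{-1}$, with the orientation induced by the counterclockwise one, and let $K$ be a finite simplicial complex triangulating $M$ that subdivides this cell decomposition. Each $a_i$, $b_i$ is then a sum of oriented edges of $K$ (the canonical homology basis). Let $C^j$ be the complex-valued simplicial $j$-cochains of $K$ and $\delta$ the coboundary. For $\sigma,\tau\in C^1$ let $\sigma\cup\tau=R(W\sigma\wedge W\tau)\in C^2$, where $W$ is the Whitney embedding, $W[p,q]=\mu_p\,d\mu_q-\mu_q\,d\mu_p$ on an oriented edge ($\mu$ = barycentric coordinates), extended linearly, and $R$ is integration over simplices. Let $[M]$ be the fundamental class, i.e. the sum of the positively oriented triangles of $K$. Let $\langle\cdot,\cdot\rangle$ be a positive definite hermitian inner product on $C^1$, linear in the first variable. A cochain $\sigma\in C^1$ is harmonic if $\delta\sigma=0$ and $\langle\sigma,\delta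 f\rangle=0$ for all $f\in C^0$ (that is, $\delta^*\sigma=0$); let $H^1$ be the space of harmonic $1$-cochains. The star operator is defined by $\langle\bigstar a,b\rangle=(a\cup\bar b)[M]$ for all $b\in C^1$. On $H^1$ we use the induced operator, again denoted by $\bigstar:H^1\to H^1$, which sends $\sigma$ to the orthogonal projection of $\bigstar\sigma$ to $H^1$; equivalently $\langle\bigstar\sigma,\tau\rangle=(\sigma\cup\bar\tau)[M]$ for all $\tau\in H^1$. The space $\mathcal H^{1,0}$ of holomorphic $1$-cochains is the subspace of $H^1$ spanned by the $\sigma\in H^1$ with $\bigstar\sigma=-i\lambda\sigma$ for some real $\lambda\ge 0$. The periods of $\sigma$ are $A_i=\sigma(a_i)$, $B_i=\sigma(b_i)$; those of $\sigma'$ are $A_i'$, $B_i'$. *Theorem.* Suppose that $\langle\cdot,\cdot\rangle$ is the hermitian extension of a real inner product on the real-valued $1$-cochains, i.e. $\langle\bar a,\bar b\rangle=\overline{\langle a,b\rangle}$ for all $a,b\in C^1$. Then for all $\sigma,\sigma'\in\mathcal H^{1,0}$ $$\sum_{i=1}^g (A_iB_i'-B_iA_i')=0,$$ and if $\lambda\in\mathbb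 R$ is such that $\bigstar\sigma=-i\lambda\sigma$, then $$-i\lambda\langle\sigma,\overline{\sigma'}\rangle=\sum_{i=1}^g (A_iB_i'-B_iA_i')=0.$$ *Corollary.* Let $\langle\cdot,\cdot\rangle$ be an arbitrary positive definite hermitian inner product on $C^1$, and let $\sigma\in\mathcal H^{1,0}$ and $\lambda\in\mathbb R$ satisfy $\bigstar\sigma=-i\lambda\sigma$. If $\sigma\neq0$ then $\lambda>0$; and if $\lambda>0$, then $$\|\sigma\|^2=\langle\sigma,\sigma\rangle=\frac{i}{\lambda}\sum_{i=1}^g\bigl(A_i\overline{B_i}-B_i\overline{A_i}\bigr)\ge 0 .$$ -/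

import Mathlib

open scoped ComplexConjugate ComplexOrder

noncomputable section

namespace CombSurface

/-! ### Simplicial complexes and complex-valued cochains in degrees 0, 1, 2 -/

/-- The ordered pair `(u, v)` spans a `1`-simplex of `K`. -/
def IsEdge {V : Type*} [DecidableEq V] (K : AbstractSimplicialComplex V) (u v : V) : Prop :=
  u ≠ v ∧ ({u, v} : Finset V) ∈ K.faces

/-- The ordered triple `(u, v, w)` spans a `2`-simplex of `K`. -/
def IsTriangle {V : Type*} [DecidableEq V] (K : AbstractSimplicialComplex V) (u v w : V) : Prop :=
  u ≠ v ∧ u ≠ w ∧ v ≠ w ∧ ({u, v, w} : Finset V) ∈ K.faces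

theorem IsEdge.symm {V : Type*} [DecidableEq V] {K : AbstractSimplicialComplex V} {u v : V}
    (h : IsEdge K u v) : IsEdge K v u :=
  ⟨h.1.symm, by rw [Finset.pair_comm]; exact h.2⟩

theorem IsTriangle.swap_left {V : Type*} [DecidableEq V] {K : AbstractSimplicialComplex V}
    {u v w : V} (h : IsTriangle K u v w) : IsTriangle K v u w :=
  ⟨h.1.symm, h.2.2.1, h.2.1, by rw [Finset.insert_comm]; exact h.2.2.2⟩

theorem IsTriangle.swap_right {V : Type*} [DecidableEq V] {K : AbstractSimplicialComplex V}
    {u v w : V} (h : IsTriangle K u v w) : IsTriangle K u w v :=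
  ⟨h.2.1, h.1, h.2.2.1.symm, by rw [Finset.pair_comm]; exact h.2.2.2⟩

/-- The geometric realization of a finite simplicial complex: barycentric coordinates
supported on a simplex, with the topology induced from `ℝ^V`. -/
def Realization {V : Type*} [Fintype V] (K : AbstractSimplicialComplex V) : Type _ :=
  {x : V → ℝ // (∀ v, 0 ≤ x v) ∧ ∑ v, x v = 1 ∧ ∃ s ∈ K.faces, ∀ v, x v ≠ 0 → v ∈ s}

instance {V : Type*} [Fintype V] (K : AbstractSimplicialComplex V) :
    TopologicalSpace (Realization K) :=
  inferInstanceAs (TopologicalSpace {x : V → ℝ // (∀ v, 0 ≤ x v) ∧ ∑ v, x v = 1 ∧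
    ∃ s ∈ K.faces, ∀ v, x v ≠ 0 → v ∈ s})

/-- Complex `1`-cochains: `σ u v` is the value on the oriented edge `[u, v]`. -/
def Cochain1 {V : Type*} [DecidableEq V] (K : AbstractSimplicialComplex V) :
    Submodule ℂ (V → V → ℂ) where
  carrier := {σ | (∀ u v, σ v u = - σ u v) ∧ ∀ u v, ¬ IsEdge K u v → σ u v = 0}
  zero_mem' := by simp
  add_mem' := by
    rintro a b ⟨ha, ha'⟩ ⟨hb, hb'⟩
    refine ⟨fun u v => ?_, fun u v h => ?_⟩
    · simp only [Pi.add_apply, ha u v, hb u v]; ring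
    · simp only [Pi.add_apply, ha' u v h, hb' u v h, add_zero]
  smul_mem' := by
    rintro c a ⟨ha, ha'⟩
    refine ⟨fun u v => ?_, fun u v h => ?_⟩
    · simp only [Pi.smul_apply, ha u v, smul_neg]
    · simp only [Pi.smul_apply, ha' u v h, smul_zero]

/-- Complex `2`-cochains: `c u v w` is the value on the oriented triangle `[u, v, w]`. -/
def Cochain2 {V : Type*} [DecidableEq V] (K : AbstractSimplicialComplex V) :
    Submodule ℂ (V → V → V → ℂ) where
  carrier := {c | (∀ u v w, c v u w = - c u v w) ∧ (∀ u v w, c u w v = - c u v w) ∧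
    ∀ u v w, ¬ IsTriangle K u v w → c u v w = 0}
  zero_mem' := by simp
  add_mem' := by
    rintro a b ⟨ha, ha', ha''⟩ ⟨hb, hb', hb''⟩
    refine ⟨fun u v w => ?_, fun u v w => ?_, fun u v w h => ?_⟩
    · simp only [Pi.add_apply, ha u v w, hb u v w]; ring
    · simp only [Pi.add_apply, ha' u v w, hb' u v w]; ring
    · simp only [Pi.add_apply, ha'' u v w h, hb'' u v w h, add_zero]
  smul_mem' := by
    rintro k a ⟨ha, ha', ha''⟩
    refine ⟨fun u v w => ?_, fun u v w => ?_, fun u v w h => ?_⟩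
    · simp only [Pi.smul_apply, ha u v w, smul_neg]
    · simp only [Pi.smul_apply, ha' u v w, smul_neg]
    · simp only [Pi.smul_apply, ha'' u v w h, smul_zero]

open Classical in
/-- The coboundary `δ : C⁰ → C¹`; a `0`-cochain is a function on the vertices. -/
def delta0 {V : Type*} [DecidableEq V] (K : AbstractSimplicialComplex V) :
    (V → ℂ) →ₗ[ℂ] Cochain1 K where
  toFun f := ⟨fun u v => if IsEdge K u v then f v - f u else 0, by
    refine ⟨fun u v => ?_, fun u v h => if_neg h⟩
    by_cases h : IsEdge K u v
    · simp [h, h.symm]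
    · have h' : ¬ IsEdge K v u := fun h' => h h'.symm
      simp [h, h']⟩
  map_add' f f' := by
    ext u v
    by_cases h : IsEdge K u v
    · simp [h]; ring
    · simp [h]
  map_smul' c f := by
    ext u v
    by_cases h : IsEdge K u v
    · simp [h]; ring
    · simp [h]

open Classical in
/-- The coboundary `δ : C¹ → C²`. -/
def delta1 {V : Type*} [DecidableEq V] (K : AbstractSimplicialComplex V) :
    Cochain1 K →ₗ[ℂ] Cochain2 K where
  toFun σ := ⟨fun u v w => if IsTriangle K u v w then σ.1 v w - σ.1 u w + σ.1 u v else 0, by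
    refine ⟨fun u v w => ?_, fun u v w => ?_, fun u v w h => if_neg h⟩
    · by_cases h : IsTriangle K u v w
      · simp only [h, h.swap_left, if_true, σ.2.1 u v]; ring
      · have h' : ¬ IsTriangle K v u w := fun h' => h h'.swap_left
        simp [h, h']
    · by_cases h : IsTriangle K u v w
      · simp only [h, h.swap_right, if_true, σ.2.1 v w]; ring
      · have h' : ¬ IsTriangle K u w v := fun h' => h h'.swap_right
        simp [h, h']⟩
  map_add' f f' := by
    ext u v w
    by_cases h : IsTriangle K u v w
    · simp [h]; ring
    · simp [h]
  map_smul' c f := by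
    ext u v w
    by_cases h : IsTriangle K u v w
    · simp [h]; ring
    · simp [h]

/-- Complex conjugation of `1`-cochains. -/
def conjCochain {V : Type*} [DecidableEq V] {K : AbstractSimplicialComplex V}
    (σ : Cochain1 K) : Cochain1 K :=
  ⟨fun u v => conj (σ.1 u v), by
    refine ⟨fun u v => ?_, fun u v h => ?_⟩
    · simp only [σ.2.1 u v, map_neg]
    · simp only [σ.2.2 u v h, map_zero]⟩

/-! ### The Whitney cochain product -/

/-- The Whitney form `W σ = ∑_{i<j} σ([x i, x j]) (μ i dμ j - μ j dμ i)` of a `1`-cochain on the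
triangle `[x 0, x 1, x 2]`, at the point with barycentric coordinates `μ`, on the tangent
vector `ξ` (written in barycentric coordinates). -/
def whitneyForm {V : Type*} (σ : V → V → ℂ) (x : Fin 3 → V) (μ ξ : Fin 3 → ℝ) : ℂ :=
  ∑ i, ∑ j ∈ Finset.Ioi i, σ (x i) (x j) * ((μ i * ξ j - μ j * ξ i : ℝ) : ℂ)

/-- The integral of `W σ ∧ W τ` over the oriented triangle `[u, v, w]`, which is parametrized
by `(s, t) ↦ (1 - s - t) u + s v + t w` for `0 ≤ s ≤ 1`, `0 ≤ t ≤ 1 - s`. -/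
def whitneyIntegral {V : Type*} (σ τ : V → V → ℂ) (u v w : V) : ℂ :=
  ∫ s in (0 : ℝ)..1, ∫ t in (0 : ℝ)..(1 - s),
    (whitneyForm σ ![u, v, w] ![1 - s - t, s, t] ![-1, 1, 0] *
        whitneyForm τ ![u, v, w] ![1 - s - t, s, t] ![-1, 0, 1] -
      whitneyForm σ ![u, v, w] ![1 - s - t, s, t] ![-1, 0, 1] *
        whitneyForm τ ![u, v, w] ![1 - s - t, s, t] ![-1, 1, 0])

theorem integral_quadratic (A B C : ℂ) (b : ℝ) :
    ∫ x in (0 : ℝ)..b, (A + (x : ℂ) * B + (x : ℂ) ^ 2 * C) =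
      (b : ℂ) * A + (b : ℂ) ^ 2 / 2 * B + (b : ℂ) ^ 3 / 3 * C := by
  rw [intervalIntegral.integral_eq_sub_of_hasDerivAt
    (f := fun x : ℝ => (x : ℂ) * A + (x : ℂ) ^ 2 / 2 * B + (x : ℂ) ^ 3 / 3 * C)]
  · simp
  · intro x _
    have h1 : HasDerivAt (fun y : ℝ => (y : ℂ)) 1 x := Complex.ofRealCLM.hasDerivAt
    have h := ((h1.mul_const A).add (((h1.pow 2).div_const 2).mul_const B)).add
      (((h1.pow 3).div_const 3).mul_const C)
    refine h.congr_deriv ?_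
    norm_num
  · exact Continuous.intervalIntegrable (by fun_prop) _ _

theorem whitneyIntegral_eq {V : Type*} (σ τ : V → V → ℂ) (u v w : V) :
    whitneyIntegral σ τ u v w = (1 / 6 : ℂ) *
      ((σ u v * τ v w - σ v w * τ u v) + (σ u v * τ u w - σ u w * τ u v) +
        (σ u w * τ v w - σ v w * τ u w)) := by
  have h0 : Finset.Ioi (0 : Fin 3) = {1, 2} := by decide
  have h1 : Finset.Ioi (1 : Fin 3) = {2} := by decide
  have h2 : Finset.Ioi (2 : Fin 3) = ∅ := by decide
  set X := σ u v * τ v w - σ v w * τ u v with hX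
  set P := σ u v * τ u w - σ u w * τ u v with hP
  set Y := σ u w * τ v w - σ v w * τ u w with hY
  have e : ∀ s t : ℝ, (whitneyForm σ ![u, v, w] ![1 - s - t, s, t] ![-1, 1, 0] *
        whitneyForm τ ![u, v, w] ![1 - s - t, s, t] ![-1, 0, 1] -
      whitneyForm σ ![u, v, w] ![1 - s - t, s, t] ![-1, 0, 1] *
        whitneyForm τ ![u, v, w] ![1 - s - t, s, t] ![-1, 1, 0]) =
      (P + (s : ℂ) * (X - P)) + (t : ℂ) * (Y - P) + (t : ℂ) ^ 2 * 0 := by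
    intro s t
    simp [whitneyForm, Fin.sum_univ_three, h0, h1, h2, hX, hP, hY]
    ring
  have e' : ∀ s : ℝ, ((1 - s : ℝ) : ℂ) * (P + (s : ℂ) * (X - P)) +
      ((1 - s : ℝ) : ℂ) ^ 2 / 2 * (Y - P) + ((1 - s : ℝ) : ℂ) ^ 3 / 3 * 0 =
      (P + (Y - P) / 2) + (s : ℂ) * ((X - P) - P - (Y - P)) +
        (s : ℂ) ^ 2 * ((Y - P) / 2 - (X - P)) := by
    intro s
    push_cast
    ring
  simp only [whitneyIntegral, e, integral_quadratic, e']
  norm_num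
  ring

open Classical in
/-- The cochain product `σ ∪ τ = R (W σ ∧ W τ)` of two `1`-cochains, where `R` integrates forms
over the simplices of `K`. -/
def cup {V : Type*} [DecidableEq V] {K : AbstractSimplicialComplex V} (σ τ : Cochain1 K) :
    Cochain2 K :=
  ⟨fun u v w => if IsTriangle K u v w then whitneyIntegral σ.1 τ.1 u v w else 0, by
    refine ⟨fun u v w => ?_, fun u v w => ?_, fun u v w h => if_neg h⟩
    · by_cases h : IsTriangle K u v w
      · simp only [h, h.swap_left, if_true, whitneyIntegral_eq, σ.2.1 u v, τ.2.1 u v]; ring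
      · have h' : ¬ IsTriangle K v u w := fun h' => h h'.swap_left
        simp [h, h']
    · by_cases h : IsTriangle K u v w
      · simp only [h, h.swap_right, if_true, whitneyIntegral_eq, σ.2.1 v w, τ.2.1 v w]; ring
      · have h' : ¬ IsTriangle K u w v := fun h' => h h'.swap_right
        simp [h, h']⟩

/-! ### Orientation and fundamental class -/

/-- An orientation of a closed triangulated surface: a choice of orientation of every triangle
(`coeff u v w = 1` if `[u, v, w]` is positively oriented and `-1` if it is negatively oriented)
such that the sum of the oriented triangles is a cycle. -/
structure SurfaceOrientation {V : Type*} [Fintype V] [DecidableEq V]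
    (K : AbstractSimplicialComplex V) where
  coeff : V → V → V → ℤ
  swap_left : ∀ u v w, coeff v u w = - coeff u v w
  swap_right : ∀ u v w, coeff u w v = - coeff u v w
  eq_zero : ∀ u v w, ¬ IsTriangle K u v w → coeff u v w = 0
  eq_one_or : ∀ u v w, IsTriangle K u v w → coeff u v w = 1 ∨ coeff u v w = -1
  cycle : ∀ u v, ∑ w, coeff u v w = 0

/-- Evaluation of a `2`-cochain on the fundamental class `[M]`, the sum of the positively oriented
triangles (each triangle occurs in the sum with its six orderings). -/
def evalFund {V : Type*} [Fintype V] [DecidableEq V] {K : AbstractSimplicialComplex V}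
    (o : SurfaceOrientation K) (c : Cochain2 K) : ℂ :=
  (1 / 6 : ℂ) * ∑ u, ∑ v, ∑ w, (o.coeff u v w : ℂ) * c.1 u v w

/-! ### Surfaces of genus `g` glued from a triangulated `4g`-gon -/

/-- `CanonicalPolygon K o g` says that the oriented complex `K` is a closed oriented surface of
genus `g` obtained by identifying the sides of a `4g`-gon, and that `K` is a subdivision of the
resulting cell decomposition.

The polygon is a triangulated closed disc `D`. Its sides, in counterclockwise order, are
`a_0, b_0, a_0⁻¹, b_0⁻¹, a_1, b_1, a_1⁻¹, b_1⁻¹, …`. The side `a_i` (respectively `b_i`) is the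
edge path `side i 0 0, …, side i 0 (len i 0)` (respectively `side i 1`), traversed
counterclockwise; the opposite side `a_i⁻¹` (respectively `b_i⁻¹`) is
`opp i 0 0, …, opp i 0 (len i 0)` (respectively `opp i 1`), traversed clockwise. The simplicial
map `proj : D → K` glues `side i s k` to `opp i s k`, and identifies nothing else. -/
structure CanonicalPolygon {V W : Type*} [Fintype V] [DecidableEq V] [Fintype W] [DecidableEq W]
    (K : AbstractSimplicialComplex V) (o : SurfaceOrientation K) (g : ℕ) [NeZero g]
    (D : AbstractSimplicialComplex W) where
  /-- `D` triangulates a closed disc. -/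
  disc : Nonempty (Realization D ≃ₜ Metric.closedBall (0 : EuclideanSpace ℝ (Fin 2)) 1)
  len : Fin g → Fin 2 → ℕ
  side : Fin g → Fin 2 → ℕ → W
  opp : Fin g → Fin 2 → ℕ → W
  len_pos : ∀ i s, 0 < len i s
  /-- The sides are consecutive, -/
  corner_a_b : ∀ i, side i 0 (len i 0) = side i 1 0
  corner_b_a' : ∀ i, side i 1 (len i 1) = opp i 0 (len i 0)
  corner_a'_b' : ∀ i, opp i 0 0 = opp i 1 (len i 1)
  corner_b'_a : ∀ i, opp i 1 0 = side (i + 1) 0 0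
  /-- they pass through each vertex at most once, -/
  side_inj : ∀ i s k i' s' k', k < len i s → k' < len i' s' →
    side i s k = side i' s' k' → i = i' ∧ s = s' ∧ k = k'
  opp_inj : ∀ i s k i' s' k', k < len i s → k' < len i' s' →
    opp i s (k + 1) = opp i' s' (k' + 1) → i = i' ∧ s = s' ∧ k = k'
  side_ne_opp : ∀ i s k i' s' k', k < len i s → k' < len i' s' →
    side i s k ≠ opp i' s' (k' + 1)
  side_edge : ∀ i s k, k < len i s → IsEdge D (side i s k) (side i s (k + 1))
  opp_edge : ∀ i s k, k < len i s → IsEdge D (opp i s k) (opp i s (k + 1))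
  /-- and they run through the boundary of the disc: the edges that lie in exactly one triangle
  are those on the sides. -/
  boundary_edge : ∀ u v, IsEdge D u v →
    ((∃! w, IsTriangle D u v w) ↔ ∃ i s k, k < len i s ∧
      (({u, v} : Finset W) = {side i s k, side i s (k + 1)} ∨
        ({u, v} : Finset W) = {opp i s k, opp i s (k + 1)}))
  proj : W → V
  /-- `proj` is simplicial, injective on each simplex, and maps onto `K`. -/
  proj_mem : ∀ s ∈ D.faces, s.image proj ∈ K.faces
  proj_injOn : ∀ s ∈ D.faces, Set.InjOn proj (s : Set W)
  proj_surj : ∀ t ∈ K.faces, ∃ s ∈ D.faces, s.image proj = t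
  /-- Two vertices have the same image exactly if the side identifications force it. -/
  glue_vertex : ∀ w w', proj w = proj w' ↔
    Relation.EqvGen (fun x y => ∃ i s k, k ≤ len i s ∧ x = side i s k ∧ y = opp i s k) w w'
  /-- Two different edges have the same image only if they are paired edges of opposite sides. -/
  glue_edge : ∀ u v u' v', IsEdge D u v → IsEdge D u' v' → proj u = proj u' → proj v = proj v' →
    (u = u' ∧ v = v') ∨ ∃ i s k, k < len i s ∧
      ((({u, v} : Finset W) = {side i s k, side i s (k + 1)} ∧
          ({u', v'} : Finset W) = {opp i s k, opp i s (k + 1)}) ∨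
        (({u, v} : Finset W) = {opp i s k, opp i s (k + 1)} ∧
          ({u', v'} : Finset W) = {side i s k, side i s (k + 1)}))
  /-- No two different triangles have the same image. -/
  glue_triangle : ∀ s ∈ D.faces, ∀ s' ∈ D.faces, s.card = 3 → s.image proj = s'.image proj → s = s'
  /-- The orientation of `K` lifts to the orientation of the polygon whose boundary is
  counterclockwise: the coefficient of `[u, v]` in the boundary of the lifted fundamental chain is
  the coefficient of `[u, v]` in `∑ (a_i + b_i - a_i' - b_i')`. -/
  oriented : ∀ u v,
    (∑ w, open Classical in if IsTriangle D u v w then o.coeff (proj u) (proj v) (proj w) else 0) =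
      ∑ i, ∑ s, ∑ k ∈ Finset.range (len i s),
        ((if (u, v) = (side i s k, side i s (k + 1)) then (1 : ℤ) else 0)
          - (if (v, u) = (side i s k, side i s (k + 1)) then (1 : ℤ) else 0)
          - (if (u, v) = (opp i s k, opp i s (k + 1)) then (1 : ℤ) else 0)
          + (if (v, u) = (opp i s k, opp i s (k + 1)) then (1 : ℤ) else 0))

namespace CanonicalPolygon

variable {V W : Type*} [Fintype V] [DecidableEq V] [Fintype W] [DecidableEq W]
  {K : AbstractSimplicialComplex V} {o : SurfaceOrientation K} {g : ℕ} [NeZero g]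
  {D : AbstractSimplicialComplex W}

/-- The value of a cochain on the cycle `a_i` (`s = 0`) or `b_i` (`s = 1`) of the canonical
homology basis: the sum of its values over the edges into which the cycle is subdivided. -/
def period (P : CanonicalPolygon K o g D) (σ : Cochain1 K) (i : Fin g) (s : Fin 2) : ℂ :=
  ∑ k ∈ Finset.range (P.len i s), σ.1 (P.proj (P.side i s k)) (P.proj (P.side i s (k + 1)))

/-- The `A`-periods `A_i = σ(a_i)`. -/
def periodA (P : CanonicalPolygon K o g D) (σ : Cochain1 K) (i : Fin g) : ℂ := P.period σ i 0

/-- The `B`-periods `B_i = σ(b_i)`. -/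
def periodB (P : CanonicalPolygon K o g D) (σ : Cochain1 K) (i : Fin g) : ℂ := P.period σ i 1

end CanonicalPolygon

/-! ### Hermitian inner products, harmonic cochains and the star operator -/

theorem riesz_core {E : Type*} [AddCommGroup E] [Module ℂ E] [FiniteDimensional ℂ E]
    (ip : InnerProductSpace.Core ℂ E) (φ : E →ₗ[ℂ] ℂ) : ∃! v : E, ∀ b, ip.inner v b = φ b := by
  let _ : NormedAddCommGroup E := ip.toNormedAddCommGroup
  let _ : InnerProductSpace ℂ E := InnerProductSpace.ofCore ip.toCore
  have _ : CompleteSpace E := FiniteDimensional.complete ℂ E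
  refine ⟨(InnerProductSpace.toDual ℂ E).symm (LinearMap.toContinuousLinearMap φ), ?_, ?_⟩
  · intro b
    exact InnerProductSpace.toDual_symm_apply
  · intro v hv
    apply (InnerProductSpace.toDual ℂ E).injective
    ext b
    simp only [LinearIsometryEquiv.apply_symm_apply]
    exact hv b

theorem evalFund_cup_conj_add {V : Type*} [Fintype V] [DecidableEq V]
    {K : AbstractSimplicialComplex V} (o : SurfaceOrientation K) (a b c : Cochain1 K) :
    evalFund o (cup a (conjCochain (b + c))) =
      evalFund o (cup a (conjCochain b)) + evalFund o (cup a (conjCochain c)) := by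
  simp only [evalFund, ← mul_add, ← Finset.sum_add_distrib]
  congr 1
  refine Finset.sum_congr rfl fun u _ => Finset.sum_congr rfl fun v _ =>
    Finset.sum_congr rfl fun w _ => ?_
  by_cases h : IsTriangle K u v w
  · simp only [cup, h, if_true, whitneyIntegral_eq, conjCochain, Submodule.coe_add,
      Pi.add_apply, map_add]
    ring
  · simp [cup, h]

theorem evalFund_cup_conj_smul {V : Type*} [Fintype V] [DecidableEq V]
    {K : AbstractSimplicialComplex V} (o : SurfaceOrientation K) (z : ℂ) (a b : Cochain1 K) :
    evalFund o (cup a (conjCochain (z • b))) = conj z * evalFund o (cup a (conjCochain b)) := by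
  simp only [evalFund, mul_left_comm (conj z), Finset.mul_sum]
  refine Finset.sum_congr rfl fun u _ => Finset.sum_congr rfl fun v _ =>
    Finset.sum_congr rfl fun w _ => ?_
  by_cases h : IsTriangle K u v w
  · simp only [cup, h, if_true, whitneyIntegral_eq, conjCochain, Submodule.coe_smul,
      Pi.smul_apply, smul_eq_mul, map_mul]
    ring
  · simp [cup, h]

section Hodge

variable {V : Type*} [Fintype V] [DecidableEq V] {K : AbstractSimplicialComplex V}

/-- The hermitian inner product `⟨a, b⟩`, linear in `a` and conjugate linear in `b`.
(Mathlib's convention for `ip.inner` is the opposite one.) -/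
def herm (ip : InnerProductSpace.Core ℂ (Cochain1 K)) (a b : Cochain1 K) : ℂ := ip.inner b a

/-- The norm `‖a‖` of the hermitian inner product. -/
def hermNorm (ip : InnerProductSpace.Core ℂ (Cochain1 K)) (a : Cochain1 K) : ℝ :=
  Real.sqrt (herm ip a a).re

/-- The hermitian inner product is the hermitian extension of a real inner product on the
real-valued cochains. -/
def IsComplexification (ip : InnerProductSpace.Core ℂ (Cochain1 K)) : Prop :=
  ∀ a b, herm ip (conjCochain a) (conjCochain b) = conj (herm ip a b)

/-- The harmonic `1`-cochains: `δ σ = 0` and `δ* σ = 0`. The second condition, for the adjoint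
`δ*` of `δ : C⁰ → C¹`, says that `σ` is orthogonal to the image of `δ`, whatever the inner product
on `C⁰` is. -/
def harmonic (ip : InnerProductSpace.Core ℂ (Cochain1 K)) : Submodule ℂ (Cochain1 K) where
  carrier := {σ | delta1 K σ = 0 ∧ ∀ f : V → ℂ, herm ip σ (delta0 K f) = 0}
  zero_mem' := by
    refine ⟨map_zero _, fun f => ?_⟩
    have h := ip.smul_left 0 (delta0 K f) 0
    rw [zero_smul, map_zero, zero_mul] at h
    rw [herm, ← ip.conj_inner_symm, h, map_zero]
  add_mem' := by
    rintro a b ⟨ha, ha'⟩ ⟨hb, hb'⟩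
    refine ⟨by rw [map_add, ha, hb, add_zero], fun f => ?_⟩
    have ha'' := ha' f
    have hb'' := hb' f
    simp only [herm] at ha'' hb'' ⊢
    rw [← ip.conj_inner_symm, ip.add_left, map_add, ip.conj_inner_symm, ip.conj_inner_symm,
      ha'', hb'', add_zero]
  smul_mem' := by
    rintro z a ⟨ha, ha'⟩
    refine ⟨by rw [map_smul, ha, smul_zero], fun f => ?_⟩
    have ha'' := ha' f
    simp only [herm] at ha'' ⊢
    rw [← ip.conj_inner_symm, ip.smul_left, map_mul, ip.conj_inner_symm, ha'', mul_zero]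

theorem exists_star (o : SurfaceOrientation K) (ip : InnerProductSpace.Core ℂ (Cochain1 K))
    (a : Cochain1 K) :
    ∃! s : Cochain1 K, ∀ b, herm ip s b = evalFund o (cup a (conjCochain b)) := by
  have key := riesz_core ip
    { toFun := fun b => conj (evalFund o (cup a (conjCochain b)))
      map_add' := fun b c => by rw [evalFund_cup_conj_add, map_add]
      map_smul' := fun z b => by
        rw [evalFund_cup_conj_smul, map_mul, Complex.conj_conj, RingHom.id_apply, smul_eq_mul] }
  have hiff : ∀ s : Cochain1 K, (∀ b, herm ip s b = evalFund o (cup a (conjCochain b))) ↔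
      ∀ b, ip.inner s b = conj (evalFund o (cup a (conjCochain b))) := by
    intro s
    refine forall_congr' fun b => ?_
    rw [← ip.conj_inner_symm s b, herm]
    exact (starRingEnd ℂ).injective.eq_iff.symm
  simp only [hiff]
  exact key

/-- The combinatorial star operator: `⟨★ a, b⟩ = (a ∪ b̄)[M]` for all `1`-cochains `b`. -/
def star (o : SurfaceOrientation K) (ip : InnerProductSpace.Core ℂ (Cochain1 K))
    (a : Cochain1 K) : Cochain1 K :=
  (exists_star o ip a).choose

theorem star_spec (o : SurfaceOrientation K) (ip : InnerProductSpace.Core ℂ (Cochain1 K))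
    (a b : Cochain1 K) : herm ip (star o ip a) b = evalFund o (cup a (conjCochain b)) :=
  (exists_star o ip a).choose_spec.1 b

theorem exists_harmonicPart (ip : InnerProductSpace.Core ℂ (Cochain1 K)) (a : Cochain1 K) :
    ∃ s ∈ harmonic ip, ∀ b ∈ harmonic ip, herm ip s b = herm ip a b := by
  let ipH : InnerProductSpace.Core ℂ (harmonic ip) :=
    { inner := fun x y => ip.inner x.1 y.1
      conj_inner_symm := fun x y => ip.conj_inner_symm x.1 y.1
      re_inner_nonneg := fun x => ip.re_inner_nonneg x.1
      add_left := fun x y z => ip.add_left x.1 y.1 z.1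
      smul_left := fun x y r => ip.smul_left x.1 y.1 r
      definite := fun x hx => Subtype.ext (ip.definite x.1 hx) }
  obtain ⟨s, hs, -⟩ := riesz_core ipH
    { toFun := fun b => ip.inner a b.1
      map_add' := fun b c => by
        rw [← ip.conj_inner_symm, Submodule.coe_add, ip.add_left, map_add, ip.conj_inner_symm,
          ip.conj_inner_symm]
      map_smul' := fun z b => by
        rw [← ip.conj_inner_symm, Submodule.coe_smul, ip.smul_left, map_mul, ip.conj_inner_symm,
          Complex.conj_conj, RingHom.id_apply, smul_eq_mul] }
  refine ⟨s.1, s.2, fun b hb => ?_⟩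
  have h : ip.inner s.1 b = ip.inner a b := hs ⟨b, hb⟩
  rw [herm, herm, ← ip.conj_inner_symm, h, ip.conj_inner_symm]

/-- The harmonic part of a `1`-cochain: its orthogonal projection to the harmonic cochains. -/
def harmonicPart (ip : InnerProductSpace.Core ℂ (Cochain1 K)) (a : Cochain1 K) : Cochain1 K :=
  (exists_harmonicPart ip a).choose

theorem harmonicPart_mem (ip : InnerProductSpace.Core ℂ (Cochain1 K)) (a : Cochain1 K) :
    harmonicPart ip a ∈ harmonic ip :=
  (exists_harmonicPart ip a).choose_spec.1

theorem herm_harmonicPart (ip : InnerProductSpace.Core ℂ (Cochain1 K)) (a : Cochain1 K)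
    {b : Cochain1 K} (hb : b ∈ harmonic ip) : herm ip (harmonicPart ip a) b = herm ip a b :=
  (exists_harmonicPart ip a).choose_spec.2 b hb

/-- The star operator induced on harmonic `1`-cochains: Poincaré duality followed by the inverse of
the inner product on the harmonic cochains, that is, the harmonic part of `★ σ`. -/
def harmonicStar (o : SurfaceOrientation K) (ip : InnerProductSpace.Core ℂ (Cochain1 K))
    (σ : Cochain1 K) : Cochain1 K :=
  harmonicPart ip (star o ip σ)

theorem harmonicPart_of_mem (ip : InnerProductSpace.Core ℂ (Cochain1 K)) {a : Cochain1 K}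
    (ha : a ∈ harmonic ip) : harmonicPart ip a = a := by
  have hd : harmonicPart ip a - a ∈ harmonic ip := sub_mem (harmonicPart_mem ip a) ha
  have h : herm ip (harmonicPart ip a) (harmonicPart ip a - a) =
      herm ip a (harmonicPart ip a - a) := herm_harmonicPart ip a hd
  have h0 : ip.inner (harmonicPart ip a - a) (harmonicPart ip a - a) = 0 := by
    have h1 := ip.add_left (harmonicPart ip a - a) a (harmonicPart ip a - a)
    rw [sub_add_cancel, ← ip.conj_inner_symm (harmonicPart ip a),
      ← ip.conj_inner_symm a (harmonicPart ip a - a)] at h1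
    simp only [herm] at h
    rw [h] at h1
    simpa using h1
  exact sub_eq_zero.mp (ip.definite _ h0)

/-- If the full star operator satisfies `★ σ = c σ` on a harmonic cochain, then so does the
induced one. -/
theorem harmonicStar_eq_of_star_eq (o : SurfaceOrientation K)
    (ip : InnerProductSpace.Core ℂ (Cochain1 K)) {σ : Cochain1 K} (hσ : σ ∈ harmonic ip) {c : ℂ}
    (h : star o ip σ = c • σ) : harmonicStar o ip σ = c • σ := by
  rw [harmonicStar, h]
  exact harmonicPart_of_mem ip ((harmonic ip).smul_mem c hσ)

/-- The space `ℋ^{1,0}` of holomorphic `1`-cochains: the subspace spanned by the harmonic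
`1`-cochains `σ` with `★ σ = -i λ σ` for some real `λ ≥ 0`, where `★` is the star operator induced
on harmonic cochains. -/
def holomorphic (o : SurfaceOrientation K) (ip : InnerProductSpace.Core ℂ (Cochain1 K)) :
    Submodule ℂ (Cochain1 K) :=
  Submodule.span ℂ {σ | σ ∈ harmonic ip ∧
    ∃ lam : ℝ, 0 ≤ lam ∧ harmonicStar o ip σ = (-Complex.I * lam) • σ}

end Hodge

end CombSurface
end

/-!
A closed cochain `σ` pulled back to the polygon is exact: the open stars of the vertices cover the
contractible disc, `σ` is a Čech cocycle for this cover, and the associated covering space has a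
section. If `f` is the resulting potential, then `δf ∪ τ` is the coboundary of the Whitney product
`f τ`, so by Stokes `(σ ∪ τ)[M]` only sees the jumps of `f` across the paired sides. Up to sign
these jumps are the periods of `σ`, whence `(σ ∪ τ)[M] = ∑ (A_i B_i' - B_i A_i')`.

For an eigencochain `★σ = -iλσ` the left side with `τ̄` for `τ` is `-iλ⟨σ, τ⟩`, which gives the
norm formula. If the inner product is real and `★τ = -iμτ`, then exchanging `σ` and `τ` in
`-iλ⟨σ, τ̄⟩` changes the sign, so `(λ + μ)⟨σ, τ̄⟩ = 0`. The eigenvalue `λ = 0` does not occur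
because every choice of periods is realized by a closed cochain, and `λ < 0` does not occur because
eigencochains for distinct eigenvalues are orthogonal.
-/

noncomputable section

namespace CombSurface

/-! ### Čech `1`-cocycles on contractible spaces -/

theorem exists_section_of_isCoveringMap {E X : Type*} [TopologicalSpace E] [TopologicalSpace X]
    [ContractibleSpace X] {p : E → X} (hp : IsCoveringMap p) (hsurj : Function.Surjective p) :
    ∃ s : C(X, E), ∀ x, p (s x) = x := by
  obtain ⟨x₀, ⟨H⟩⟩ := id_nullhomotopic X
  obtain ⟨e₀, he₀⟩ := hsurj x₀
  have hstart : ∀ x, H.symm.toContinuousMap (0, x) = p (ContinuousMap.const X e₀ x) := fun x =>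
    (H.symm.apply_zero x).trans he₀.symm
  let L := hp.liftHomotopy H.symm.toContinuousMap (ContinuousMap.const X e₀) hstart
  refine ⟨L.comp ⟨fun x => (1, x), by fun_prop⟩, fun x => ?_⟩
  exact (congrFun (hp.liftHomotopy_lifts _ _ hstart) (1, x)).trans (H.symm.apply_one x)

section Cech

variable {ι X A : Type*} [TopologicalSpace X] [AddGroup A] {U : ι → Set X} {c : ι → ι → A}

/-- The principal bundle with discrete fibre `A` that a Čech `1`-cocycle `c` on an open cover `U`
defines: the transition from `U i` to `U j` is translation by `c i j`. Its total space covers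
`X`, and a section of it is a primitive of `c`. -/
def cechBundle [TopologicalSpace A] [DiscreteTopology A] (hU : ∀ i, IsOpen (U i))
    (hcover : ∀ x, ∃ i, x ∈ U i)
    (hc : ∀ i j k, (U i ∩ U j ∩ U k).Nonempty → c i j + c j k = c i k) :
    FiberBundleCore ι X A where
  baseSet := U
  isOpen_baseSet := hU
  indexAt x := (hcover x).choose
  mem_baseSet_at x := (hcover x).choose_spec
  coordChange i j _ z := z + c i j
  coordChange_self i x hx z := by
    have h : c i i + c i i = c i i := hc i i i ⟨x, ⟨hx, hx⟩, hx⟩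
    rw [add_eq_left.mp h, add_zero]
  continuousOn_coordChange i j :=
    (continuous_of_discreteTopology (f := fun z : A => z + c i j)).comp_continuousOn
      continuousOn_snd
  coordChange_comp i j k x hx z := by rw [add_assoc, hc i j k ⟨x, hx⟩]

theorem exists_primitive_of_cech_cocycle [ContractibleSpace X] (hU : ∀ i, IsOpen (U i))
    (hconn : ∀ i, IsConnected (U i)) (hcover : ∀ x, ∃ i, x ∈ U i)
    (hc : ∀ i j k, (U i ∩ U j ∩ U k).Nonempty → c i j + c j k = c i k) :
    ∃ f : ι → A, ∀ i j, (U i ∩ U j).Nonempty → f j = f i + c i j := by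
  let _ : TopologicalSpace A := ⊥
  have _ : DiscreteTopology A := ⟨rfl⟩
  let Z := cechBundle hU hcover hc
  have hcovering : IsCoveringMap Z.proj := IsFiberBundle.isCoveringMap fun x =>
    ⟨Z.localTriv (Z.indexAt x), Z.mem_baseSet_at x⟩
  obtain ⟨s, hs⟩ := exists_section_of_isCoveringMap hcovering fun x => ⟨⟨x, (0 : A)⟩, rfl⟩
  let coord : ι → X → A := fun i x => (Z.localTriv i (s x)).2
  have hcoord_cont : ∀ i, ContinuousOn (coord i) (U i) := fun i => by
    have hmaps : Set.MapsTo s (U i) (Z.localTriv i).source := fun x hx =>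
      (Z.mem_localTriv_source i (s x)).mpr (show Z.proj (s x) ∈ U i from (hs x).symm ▸ hx)
    exact continuous_snd.comp_continuousOn
      ((Z.localTriv i).continuousOn.comp s.continuous.continuousOn hmaps)
  have hcoord_const : ∀ {i x}, x ∈ U i → coord i (hconn i).nonempty.some = coord i x :=
    fun {i} _ hx => (hconn i).isPreconnected.constant (hcoord_cont i)
      (hconn i).nonempty.some_mem hx
  refine ⟨fun i => coord i (hconn i).nonempty.some, fun i j ⟨x, hi, hj⟩ => ?_⟩
  have hindex : x ∈ Z.baseSet (Z.indexAt (s x).proj) := by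
    simpa only [show (s x).proj = x from hs x] using Z.mem_baseSet_at x
  have htrans : coord j x = coord i x + c i j :=
    (Z.coordChange_comp (Z.indexAt (s x).proj) i j x ⟨⟨hindex, hi⟩, hj⟩ (s x).2).symm
  simpa only [hcoord_const hi, hcoord_const hj] using htrans

end Cech

/-! ### Simplicial cochains -/

theorem mem_faces_of_subset {W : Type*} {D : AbstractSimplicialComplex W} {s t : Finset W}
    (hs : s ∈ D.faces) (hts : t ⊆ s) (ht : t.Nonempty) : t ∈ D.faces :=
  (D.isRelLowerSet_faces hs).2 hts ht

section Cochains

variable {W : Type*} [DecidableEq W] {D : AbstractSimplicialComplex W}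

theorem IsTriangle.isEdge_left {u v w : W} (h : IsTriangle D u v w) : IsEdge D u v :=
  ⟨h.1, mem_faces_of_subset h.2.2.2 (by grind) (Finset.insert_nonempty _ _)⟩

theorem IsTriangle.isEdge_right {u v w : W} (h : IsTriangle D u v w) : IsEdge D v w :=
  ⟨h.2.2.1, mem_faces_of_subset h.2.2.2 (by grind) (Finset.insert_nonempty _ _)⟩

theorem IsTriangle.isEdge_outer {u v w : W} (h : IsTriangle D u v w) : IsEdge D u w :=
  h.swap_right.isEdge_left

theorem Cochain1.apply_self (σ : Cochain1 D) (u : W) : σ.1 u u = 0 :=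
  σ.2.2 u u fun h => h.1 rfl

theorem delta0_apply_of_isEdge (f : W → ℂ) {u v : W} (h : IsEdge D u v) :
    (delta0 D f).1 u v = f v - f u := if_pos h

theorem delta1_apply_of_isTriangle (σ : Cochain1 D) {u v w : W} (h : IsTriangle D u v w) :
    (delta1 D σ).1 u v w = σ.1 v w - σ.1 u w + σ.1 u v := if_pos h

theorem eq_delta0_iff {σ : Cochain1 D} {f : W → ℂ} :
    σ = delta0 D f ↔ ∀ u v, IsEdge D u v → σ.1 u v = f v - f u := by
  refine ⟨fun h u v he => h ▸ delta0_apply_of_isEdge f he, fun h => ?_⟩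
  ext u v
  by_cases he : IsEdge D u v
  · rw [h u v he, delta0_apply_of_isEdge f he]
  · rw [σ.2.2 u v he, (delta0 D f).2.2 u v he]

theorem delta1_eq_zero_iff {σ : Cochain1 D} :
    delta1 D σ = 0 ↔ ∀ u v w, IsTriangle D u v w → σ.1 u v + σ.1 v w = σ.1 u w := by
  constructor
  · intro h u v w ht
    have hzero : σ.1 v w - σ.1 u w + σ.1 u v = 0 := by
      rw [← delta1_apply_of_isTriangle σ ht, h]
      rfl
    linear_combination hzero
  · intro h
    ext u v w
    by_cases ht : IsTriangle D u v w
    · rw [delta1_apply_of_isTriangle σ ht]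
      change _ = (0 : ℂ)
      linear_combination h u v w ht
    · exact (delta1 D σ).2.2.2 u v w ht

theorem delta1_delta0 (f : W → ℂ) : delta1 D (delta0 D f) = 0 := by
  refine delta1_eq_zero_iff.mpr fun u v w h => ?_
  rw [delta0_apply_of_isEdge f h.isEdge_left, delta0_apply_of_isEdge f h.isEdge_right,
    delta0_apply_of_isEdge f h.isEdge_outer]
  ring

theorem cocycle_of_mem_faces {σ : Cochain1 D} (hσ : delta1 D σ = 0) {t : Finset W}
    (ht : t ∈ D.faces) {u v w : W} (hu : u ∈ t) (hv : v ∈ t) (hw : w ∈ t) :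
    σ.1 u v + σ.1 v w = σ.1 u w := by
  rcases eq_or_ne u v with rfl | huv
  · rw [Cochain1.apply_self σ, zero_add]
  rcases eq_or_ne v w with rfl | hvw
  · rw [Cochain1.apply_self σ, add_zero]
  rcases eq_or_ne u w with rfl | huw
  · rw [Cochain1.apply_self σ, σ.2.1 u v, add_neg_cancel]
  exact delta1_eq_zero_iff.mp hσ u v w
    ⟨huv, huw, hvw, mem_faces_of_subset ht (by grind) (Finset.insert_nonempty _ _)⟩

end Cochains

/-! ### Closed `1`-cochains on contractible complexes -/

section Realization

variable {W : Type*} [Fintype W] {D : AbstractSimplicialComplex W}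

variable (D) in
/-- The open star of the vertex `a`: the points with nonzero barycentric coordinate at `a`. The
stars form an open cover by connected sets, whose nerve is `D`. -/
def openStar (a : W) : Set (Realization D) := {x | x.1 a ≠ 0}

theorem isOpen_openStar (a : W) : IsOpen (openStar D a) :=
  isOpen_ne_fun (f := fun x : Realization D => x.1 a)
    ((continuous_apply a).comp continuous_subtype_val) continuous_const

theorem exists_mem_openStar (x : Realization D) : ∃ a, x ∈ openStar D a := by
  by_contra! h
  have hzero : ∀ a, x.1 a = 0 := fun a => not_not.mp (h a)
  simpa [hzero] using x.2.2.1

theorem exists_mem_faces_of_mem_openStar (x : Realization D) :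
    ∃ t ∈ D.faces, ∀ a, x ∈ openStar D a → a ∈ t :=
  x.2.2.2

theorem exists_forall_mem_openStar {t : Finset W} (ht : t ∈ D.faces) :
    ∃ x : Realization D, ∀ a ∈ t, x ∈ openStar D a := by
  classical
  have hcard : (t.card : ℝ) ≠ 0 := by
    exact_mod_cast (D.isRelLowerSet_faces ht).1.card_ne_zero
  refine ⟨⟨fun a => if a ∈ t then (t.card : ℝ)⁻¹ else 0, fun a => by positivity, ?_, t, ht, ?_⟩, ?_⟩
  · simp [Finset.sum_ite_mem, hcard]
  · intro a ha
    by_contra hat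
    exact ha (if_neg hat)
  · intro a ha
    change (if a ∈ t then (t.card : ℝ)⁻¹ else 0) ≠ 0
    rw [if_pos ha]
    exact inv_ne_zero hcard

theorem starConvex_image_openStar [DecidableEq W] (a : W) :
    StarConvex ℝ (Pi.single a 1) (Subtype.val '' openStar D a : Set (W → ℝ)) := by
  rintro _ ⟨x, hx, rfl⟩ r t hr ht hrt
  obtain ⟨s, hs, hxs⟩ := x.2.2.2
  have hsingle : (0 : W → ℝ) ≤ Pi.single a 1 := Pi.single_nonneg.mpr zero_le_one
  have hcoord : ∀ b, 0 ≤ r * (Pi.single a 1 : W → ℝ) b + t * x.1 b := fun b =>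
    add_nonneg (mul_nonneg hr (hsingle b)) (mul_nonneg ht (x.2.1 b))
  refine ⟨⟨r • Pi.single a 1 + t • x.1, hcoord, ?_, s, hs, fun b hb => ?_⟩, ?_, rfl⟩
  · simp [Finset.sum_add_distrib, ← Finset.mul_sum, x.2.2.1, hrt]
  · rcases eq_or_ne b a with rfl | hba
    · exact hxs b hx
    · exact hxs b fun h0 => hb (by simp [hba, h0])
  · have hxa : 0 < x.1 a := lt_of_le_of_ne (x.2.1 a) (Ne.symm hx)
    have hpos : 0 < r * 1 + t * x.1 a := by
      rcases hr.eq_or_lt with rfl | hr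
      · have : t = 1 := by linarith
        simpa [this] using hxa
      · positivity
    change r * (Pi.single a 1 : W → ℝ) a + t * x.1 a ≠ 0
    simpa only [Pi.single_eq_same] using hpos.ne'

theorem isConnected_openStar (a : W) : IsConnected (openStar D a) := by
  classical
  obtain ⟨x, hx⟩ := exists_forall_mem_openStar (D.singleton_mem a)
  have hne : (openStar D a).Nonempty := ⟨x, hx a (Finset.mem_singleton_self a)⟩
  have himage : IsPathConnected (Subtype.val '' openStar D a : Set (W → ℝ)) := by
    have hstar := starConvex_image_openStar (D := D) a
    exact hstar.isPathConnected (hstar.mem (hne.image _))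
  exact ⟨hne, Topology.IsInducing.subtypeVal.isPreconnected_image.mp
    himage.isConnected.isPreconnected⟩

theorem exists_eq_delta0 [DecidableEq W] [ContractibleSpace (Realization D)] {σ : Cochain1 D}
    (hσ : delta1 D σ = 0) : ∃ f : W → ℂ, σ = delta0 D f := by
  obtain ⟨f, hf⟩ := exists_primitive_of_cech_cocycle (c := σ.1) (isOpen_openStar (D := D))
    isConnected_openStar exists_mem_openStar <| by
      rintro a b d ⟨x, ⟨ha, hb⟩, hd⟩
      obtain ⟨t, ht, hxt⟩ := exists_mem_faces_of_mem_openStar x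
      exact cocycle_of_mem_faces hσ ht (hxt a ha) (hxt b hb) (hxt d hd)
  refine ⟨f, eq_delta0_iff.mpr fun a b hab => ?_⟩
  obtain ⟨x, hx⟩ := exists_forall_mem_openStar hab.2
  rw [hf a b ⟨x, hx a (by simp), hx b (by simp)⟩, add_sub_cancel_left]

end Realization

/-! ### Pulling cochains back to the polygon -/

section Pullback

variable {V W : Type*} [DecidableEq V] [DecidableEq W] {K : AbstractSimplicialComplex V}
  {D : AbstractSimplicialComplex W}

variable (D) in
open Classical in
/-- The pullback of a `1`-cochain along a vertex map. It commutes with the coboundary when the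
vertex map is simplicial. -/
def pullback (φ : W → V) (σ : Cochain1 K) : Cochain1 D :=
  ⟨fun u v => if IsEdge D u v then σ.1 (φ u) (φ v) else 0, by
    refine ⟨fun u v => ?_, fun u v h => if_neg h⟩
    by_cases h : IsEdge D u v
    · simp only [h, h.symm, if_true, σ.2.1 (φ u)]
    · have h' : ¬ IsEdge D v u := fun h' => h h'.symm
      simp only [h, h', if_false, neg_zero]⟩

theorem pullback_apply_of_isEdge (φ : W → V) (σ : Cochain1 K) {u v : W} (h : IsEdge D u v) :
    (pullback D φ σ).1 u v = σ.1 (φ u) (φ v) := if_pos h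

theorem delta1_pullback {φ : W → V} (hφ : ∀ t ∈ D.faces, t.image φ ∈ K.faces) {σ : Cochain1 K}
    (hσ : delta1 K σ = 0) : delta1 D (pullback D φ σ) = 0 := by
  refine delta1_eq_zero_iff.mpr fun u v w h => ?_
  rw [pullback_apply_of_isEdge φ σ h.isEdge_left, pullback_apply_of_isEdge φ σ h.isEdge_right,
    pullback_apply_of_isEdge φ σ h.isEdge_outer]
  exact cocycle_of_mem_faces hσ (hφ _ h.2.2.2) (Finset.mem_image_of_mem φ (by simp))
    (Finset.mem_image_of_mem φ (by simp)) (Finset.mem_image_of_mem φ (by simp))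

theorem pullback_delta0 {φ : W → V} (hφ : ∀ t ∈ D.faces, t.image φ ∈ K.faces) (F : V → ℂ) :
    pullback D φ (delta0 K F) = delta0 D (F ∘ φ) := by
  refine eq_delta0_iff.mpr fun u v h => ?_
  rw [pullback_apply_of_isEdge φ _ h]
  rcases eq_or_ne (φ u) (φ v) with huv | huv
  · simp only [Function.comp_apply, huv, Cochain1.apply_self, sub_self]
  · exact delta0_apply_of_isEdge F ⟨huv, by simpa [Finset.image_insert] using hφ _ h.2⟩

end Pullback

namespace CanonicalPolygon

variable {V W : Type*} [Fintype V] [DecidableEq V] [Fintype W] [DecidableEq W]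
  {K : AbstractSimplicialComplex V} {o : SurfaceOrientation K} {g : ℕ} [NeZero g]
  {D : AbstractSimplicialComplex W}

theorem isEdge_proj (P : CanonicalPolygon K o g D) {u v : W} (h : IsEdge D u v) :
    IsEdge K (P.proj u) (P.proj v) :=
  ⟨fun he => h.1 (P.proj_injOn _ h.2 (by simp) (by simp) he),
    by simpa [Finset.image_insert] using P.proj_mem _ h.2⟩

theorem exists_isTriangle_lift (P : CanonicalPolygon K o g D) {a b c : V}
    (h : IsTriangle K a b c) :
    ∃ u v w, IsTriangle D u v w ∧ P.proj u = a ∧ P.proj v = b ∧ P.proj w = c := by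
  obtain ⟨s, hs, hst⟩ := P.proj_surj _ h.2.2.2
  have hlift : ∀ x ∈ ({a, b, c} : Finset V), ∃ u ∈ s, P.proj u = x := fun x hx =>
    Finset.mem_image.mp (hst ▸ hx)
  obtain ⟨u, hu, rfl⟩ := hlift a (by simp)
  obtain ⟨v, hv, rfl⟩ := hlift b (by simp)
  obtain ⟨w, hw, rfl⟩ := hlift c (by simp)
  exact ⟨u, v, w, ⟨ne_of_apply_ne _ h.1, ne_of_apply_ne _ h.2.1, ne_of_apply_ne _ h.2.2.1,
    mem_faces_of_subset hs (by grind) (Finset.insert_nonempty _ _)⟩, rfl, rfl, rfl⟩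

theorem exists_isEdge_lift (P : CanonicalPolygon K o g D) {a b : V} (h : IsEdge K a b) :
    ∃ u v, IsEdge D u v ∧ P.proj u = a ∧ P.proj v = b := by
  obtain ⟨s, hs, hst⟩ := P.proj_surj _ h.2
  have hlift : ∀ x ∈ ({a, b} : Finset V), ∃ u ∈ s, P.proj u = x := fun x hx =>
    Finset.mem_image.mp (hst ▸ hx)
  obtain ⟨u, hu, rfl⟩ := hlift a (by simp)
  obtain ⟨v, hv, rfl⟩ := hlift b (by simp)
  exact ⟨u, v, ⟨ne_of_apply_ne _ h.1,
    mem_faces_of_subset hs (by grind) (Finset.insert_nonempty _ _)⟩, rfl, rfl⟩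

theorem isTriangle_eq_of_proj_eq (P : CanonicalPolygon K o g D) {u v w u' v' w' : W}
    (h : IsTriangle D u v w) (h' : IsTriangle D u' v' w') (hu : P.proj u = P.proj u')
    (hv : P.proj v = P.proj v') (hw : P.proj w = P.proj w') : u = u' ∧ v = v' ∧ w = w' := by
  have hs : ({u, v, w} : Finset W) = {u', v', w'} := by
    refine P.glue_triangle _ h.2.2.2 _ h'.2.2.2 ?_ ?_
    · exact Finset.card_eq_three.mpr ⟨u, v, w, h.1, h.2.1, h.2.2.1, rfl⟩
    · simp [Finset.image_insert, hu, hv, hw]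
  have hinj := P.proj_injOn _ h.2.2.2
  refine ⟨hinj (by simp) ?_ hu, hinj (by simp) ?_ hv, hinj (by simp) ?_ hw⟩ <;>
    simp [hs]

theorem delta1_eq_zero_of_pullback (P : CanonicalPolygon K o g D) {σ : Cochain1 K}
    (hσ : delta1 D (pullback D P.proj σ) = 0) : delta1 K σ = 0 := by
  refine delta1_eq_zero_iff.mpr fun a b c h => ?_
  obtain ⟨u, v, w, hT, rfl, rfl, rfl⟩ := P.exists_isTriangle_lift h
  rw [← pullback_apply_of_isEdge P.proj σ hT.isEdge_left,
    ← pullback_apply_of_isEdge P.proj σ hT.isEdge_right,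
    ← pullback_apply_of_isEdge P.proj σ hT.isEdge_outer]
  exact delta1_eq_zero_iff.mp hσ u v w hT

theorem exists_pullback_eq (P : CanonicalPolygon K o g D) {τ : Cochain1 D}
    (hτ : ∀ u v u' v', IsEdge D u v → IsEdge D u' v' → P.proj u = P.proj u' →
      P.proj v = P.proj v' → τ.1 u v = τ.1 u' v') :
    ∃ σ : Cochain1 K, pullback D P.proj σ = τ := by
  let edgeMap : {e : W × W // IsEdge D e.1 e.2} → V × V := fun e => (P.proj e.1.1, P.proj e.1.2)
  let value : V × V → ℂ := Function.extend edgeMap (fun e => τ.1 e.1.1 e.1.2) 0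
  have hfactors : Function.FactorsThrough
      (fun e : {e : W × W // IsEdge D e.1 e.2} => τ.1 e.1.1 e.1.2) edgeMap := fun e e' h =>
    hτ _ _ _ _ e.2 e'.2 (congrArg Prod.fst h) (congrArg Prod.snd h)
  have hvalue : ∀ {u v}, IsEdge D u v → value (P.proj u, P.proj v) = τ.1 u v := fun {u v} h =>
    hfactors.extend_apply 0 ⟨(u, v), h⟩
  have hzero : ∀ a b, ¬ IsEdge K a b → value (a, b) = 0 := fun a b h =>
    Function.extend_apply' _ _ _ fun ⟨e, he⟩ => h <| by
      obtain ⟨rfl, rfl⟩ := Prod.mk.inj he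
      exact P.isEdge_proj e.2
  have hanti : ∀ a b, value (b, a) = -value (a, b) := by
    intro a b
    by_cases h : IsEdge K a b
    · obtain ⟨u, v, he, rfl, rfl⟩ := P.exists_isEdge_lift h
      rw [hvalue he, hvalue he.symm, τ.2.1]
    · rw [hzero a b h, hzero b a fun h' => h h'.symm, neg_zero]
  refine ⟨⟨fun a b => value (a, b), hanti, hzero⟩, ?_⟩
  ext u v
  by_cases h : IsEdge D u v
  · rw [pullback_apply_of_isEdge P.proj _ h]
    exact hvalue h
  · rw [τ.2.2 u v h, (pullback D P.proj _).2.2 u v h]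

/-! ### Potentials and their jumps across the sides -/

theorem proj_side_eq_proj_opp (P : CanonicalPolygon K o g D) {i : Fin g} {s : Fin 2} {k : ℕ}
    (hk : k ≤ P.len i s) : P.proj (P.side i s k) = P.proj (P.opp i s k) :=
  (P.glue_vertex _ _).mpr (Relation.EqvGen.rel _ _ ⟨i, s, k, hk, rfl, rfl⟩)

/-- `f` is a potential of `σ` on the polygon: the pullback of `σ` is `δ f`. Closed cochains are
exact only after this cut along the sides, where `f` jumps by the periods of `σ`. -/
def IsPotential (P : CanonicalPolygon K o g D) (σ : Cochain1 K) (f : W → ℂ) : Prop :=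
  pullback D P.proj σ = delta0 D f

theorem exists_isPotential (P : CanonicalPolygon K o g D) {σ : Cochain1 K}
    (hσ : delta1 K σ = 0) : ∃ f, P.IsPotential σ f := by
  obtain ⟨φ⟩ := P.disc
  have : ContractibleSpace (Metric.closedBall (0 : EuclideanSpace ℝ (Fin 2)) 1) :=
    (convex_closedBall _ _).contractibleSpace (Metric.nonempty_closedBall.mpr zero_le_one)
  have : ContractibleSpace (Realization D) := φ.contractibleSpace
  exact exists_eq_delta0 (delta1_pullback P.proj_mem hσ)

namespace IsPotential

variable {P : CanonicalPolygon K o g D} {σ : Cochain1 K} {f : W → ℂ}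

theorem apply_proj (hf : P.IsPotential σ f) {u v : W} (h : IsEdge D u v) :
    σ.1 (P.proj u) (P.proj v) = f v - f u := by
  rw [← pullback_apply_of_isEdge P.proj σ h, eq_delta0_iff.mp hf u v h]

theorem jump_eq_jump_zero (hf : P.IsPotential σ f) (i : Fin g) (s : Fin 2) {k : ℕ}
    (hk : k ≤ P.len i s) :
    f (P.opp i s k) - f (P.side i s k) = f (P.opp i s 0) - f (P.side i s 0) := by
  induction k with
  | zero => rfl
  | succ k ih =>
    have hside := hf.apply_proj (P.side_edge i s k hk)
    have hopp := hf.apply_proj (P.opp_edge i s k hk)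
    rw [← P.proj_side_eq_proj_opp hk, ← P.proj_side_eq_proj_opp (Nat.le_of_succ_le hk)] at hopp
    linear_combination ih (Nat.le_of_succ_le hk) + hside - hopp

theorem period_eq (hf : P.IsPotential σ f) (i : Fin g) (s : Fin 2) :
    P.period σ i s = f (P.side i s (P.len i s)) - f (P.side i s 0) := by
  rw [period, ← Finset.sum_range_sub (fun k => f (P.side i s k))]
  exact Finset.sum_congr rfl fun k hk => hf.apply_proj (P.side_edge i s k (Finset.mem_range.mp hk))

theorem jump_a (hf : P.IsPotential σ f) (i : Fin g) {k : ℕ} (hk : k ≤ P.len i 0) :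
    f (P.opp i 0 k) - f (P.side i 0 k) = P.periodB σ i := by
  rw [periodB, hf.period_eq, hf.jump_eq_jump_zero i 0 hk, ← hf.jump_eq_jump_zero i 0 le_rfl,
    P.corner_a_b, P.corner_b_a']

theorem jump_b (hf : P.IsPotential σ f) (i : Fin g) {k : ℕ} (hk : k ≤ P.len i 1) :
    f (P.opp i 1 k) - f (P.side i 1 k) = -P.periodA σ i := by
  have hend := hf.jump_a i le_rfl
  have hstart := hf.jump_a i (Nat.zero_le _)
  rw [periodA, hf.period_eq, hf.jump_eq_jump_zero i 1 hk, ← hf.jump_eq_jump_zero i 1 le_rfl,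
    ← P.corner_a'_b', P.corner_b_a']
  linear_combination hstart - hend

end IsPotential

end CanonicalPolygon

/-! ### Stokes' theorem on the polygon -/

section WhitneyProduct

variable {W : Type*} [DecidableEq W] {D : AbstractSimplicialComplex W}

/-- The Whitney product of a `0`-cochain with a `1`-cochain: on an edge the linear interpolant
of `f` has mean `(f u + f v) / 2`. -/
def meanMul (f : W → ℂ) (τ : Cochain1 D) : Cochain1 D :=
  ⟨fun u v => (f u + f v) / 2 * τ.1 u v, fun u v => by simp only [τ.2.1 u v]; ring,
    fun u v h => by simp only [τ.2.2 u v h, mul_zero]⟩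

theorem meanMul_apply (f : W → ℂ) (τ : Cochain1 D) (u v : W) :
    (meanMul f τ).1 u v = (f u + f v) / 2 * τ.1 u v := rfl

theorem cup_apply_of_isTriangle (σ τ : Cochain1 D) {u v w : W} (h : IsTriangle D u v w) :
    (cup σ τ).1 u v w = 1 / 6 * ((σ.1 u v * τ.1 v w - σ.1 v w * τ.1 u v) +
      (σ.1 u v * τ.1 u w - σ.1 u w * τ.1 u v) + (σ.1 u w * τ.1 v w - σ.1 v w * τ.1 u w)) :=
  (if_pos h).trans (whitneyIntegral_eq σ.1 τ.1 u v w)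

theorem cup_delta0 (f : W → ℂ) {τ : Cochain1 D} (hτ : delta1 D τ = 0) :
    cup (delta0 D f) τ = delta1 D (meanMul f τ) := by
  ext u v w
  by_cases h : IsTriangle D u v w
  · rw [cup_apply_of_isTriangle _ _ h, delta1_apply_of_isTriangle _ h,
      delta0_apply_of_isEdge f h.isEdge_left, delta0_apply_of_isEdge f h.isEdge_right,
      delta0_apply_of_isEdge f h.isEdge_outer]
    simp only [meanMul_apply]
    rw [← delta1_eq_zero_iff.mp hτ u v w h]
    ring
  · rw [(cup _ τ).2.2.2 u v w h, (delta1 D _).2.2.2 u v w h]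

end WhitneyProduct

theorem sum_alternating_mul {R W : Type*} [CommRing R] [Fintype W] {c : W → W → W → R}
    (hleft : ∀ u v w, c v u w = -c u v w) (hright : ∀ u v w, c u w v = -c u v w)
    (h : W → W → R) :
    ∑ u, ∑ v, ∑ w, c u v w * (h v w - h u w + h u v) = 3 * ∑ u, ∑ v, h u v * ∑ w, c u v w := by
  have hfirst : ∑ u, ∑ v, ∑ w, c u v w * h u v = ∑ u, ∑ v, h u v * ∑ w, c u v w := by
    simp only [Finset.mul_sum, mul_comm]
  have hlast : ∑ u, ∑ v, ∑ w, c u v w * h v w = ∑ u, ∑ v, ∑ w, c u v w * h u v := by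
    rw [Finset.sum_comm]
    refine Finset.sum_congr rfl fun u _ => ?_
    rw [Finset.sum_comm]
    refine Finset.sum_congr rfl fun v _ => Finset.sum_congr rfl fun w _ => ?_
    rw [hleft u w v, hright u v w, neg_neg]
  have houter : ∑ u, ∑ v, ∑ w, c u v w * h u w = -∑ u, ∑ v, ∑ w, c u v w * h u v := by
    simp only [← Finset.sum_neg_distrib]
    refine Finset.sum_congr rfl fun u _ => ?_
    rw [Finset.sum_comm]
    refine Finset.sum_congr rfl fun v _ => Finset.sum_congr rfl fun w _ => ?_
    rw [hright u v w, neg_mul]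
  simp only [mul_sub, mul_add, Finset.sum_sub_distrib, Finset.sum_add_distrib, hlast, houter,
    hfirst]
  ring

theorem sum_mul_edge_indicator {W R : Type*} [Fintype W] [DecidableEq W] [CommRing R]
    {h : W → W → R} (hh : ∀ u v, h v u = -h u v) (a b : W) :
    ∑ e : W × W, h e.1 e.2 *
      ((if e = (a, b) then 1 else 0) - (if e.swap = (a, b) then 1 else 0)) = 2 * h a b := by
  simp only [Prod.swap_eq_iff_eq_swap, Prod.swap_prod_mk, mul_sub, mul_ite, mul_one, mul_zero,
    Finset.sum_sub_distrib, Finset.sum_ite_eq', Finset.mem_univ, if_true, hh a b]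
  ring

namespace CanonicalPolygon

variable {V W : Type*} [Fintype V] [DecidableEq V] [Fintype W] [DecidableEq W]
  {K : AbstractSimplicialComplex V} {o : SurfaceOrientation K} {g : ℕ} [NeZero g]
  {D : AbstractSimplicialComplex W}

theorem isTriangle_proj (P : CanonicalPolygon K o g D) {u v w : W} (h : IsTriangle D u v w) :
    IsTriangle K (P.proj u) (P.proj v) (P.proj w) :=
  ⟨(P.isEdge_proj h.isEdge_left).1, (P.isEdge_proj h.isEdge_outer).1,
    (P.isEdge_proj h.isEdge_right).1,
    by simpa [Finset.image_insert] using P.proj_mem _ h.2.2.2⟩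

open Classical in
/-- The lift of the fundamental class of `K` to a `2`-chain of the polygon. -/
def liftCoeff (P : CanonicalPolygon K o g D) (u v w : W) : ℤ :=
  if IsTriangle D u v w then o.coeff (P.proj u) (P.proj v) (P.proj w) else 0

theorem liftCoeff_of_isTriangle (P : CanonicalPolygon K o g D) {u v w : W}
    (h : IsTriangle D u v w) :
    P.liftCoeff u v w = o.coeff (P.proj u) (P.proj v) (P.proj w) := if_pos h

theorem liftCoeff_of_not_isTriangle (P : CanonicalPolygon K o g D) {u v w : W}
    (h : ¬ IsTriangle D u v w) : P.liftCoeff u v w = 0 := if_neg h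

theorem liftCoeff_swap_left (P : CanonicalPolygon K o g D) (u v w : W) :
    P.liftCoeff v u w = -P.liftCoeff u v w := by
  by_cases h : IsTriangle D u v w
  · rw [P.liftCoeff_of_isTriangle h, P.liftCoeff_of_isTriangle h.swap_left, o.swap_left]
  · rw [P.liftCoeff_of_not_isTriangle h,
      P.liftCoeff_of_not_isTriangle fun h' => h h'.swap_left, neg_zero]

theorem liftCoeff_swap_right (P : CanonicalPolygon K o g D) (u v w : W) :
    P.liftCoeff u w v = -P.liftCoeff u v w := by
  by_cases h : IsTriangle D u v w
  · rw [P.liftCoeff_of_isTriangle h, P.liftCoeff_of_isTriangle h.swap_right, o.swap_right]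
  · rw [P.liftCoeff_of_not_isTriangle h,
      P.liftCoeff_of_not_isTriangle fun h' => h h'.swap_right, neg_zero]

/-- Evaluation of a `2`-cochain of the polygon on the lifted fundamental class. As in `evalFund`,
each triangle occurs in the sum with its six orderings. -/
def evalLift (P : CanonicalPolygon K o g D) (c : Cochain2 D) : ℂ :=
  (1 / 6 : ℂ) * ∑ u, ∑ v, ∑ w, (P.liftCoeff u v w : ℂ) * c.1 u v w

theorem evalFund_eq_evalLift (P : CanonicalPolygon K o g D) {c : Cochain2 K} {c' : Cochain2 D}
    (h : ∀ u v w, IsTriangle D u v w → c'.1 u v w = c.1 (P.proj u) (P.proj v) (P.proj w)) :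
    evalFund o c = P.evalLift c' := by
  classical
  rw [evalFund, evalLift]
  simp only [← Fintype.sum_prod_type']
  congr 1
  symm
  rw [← Finset.sum_filter_of_ne (p := fun e : W × W × W => IsTriangle D e.1 e.2.1 e.2.2)
    fun e _ he => by_contra fun hT => he <| by
      rw [P.liftCoeff_of_not_isTriangle hT, Int.cast_zero, zero_mul]]
  refine Finset.sum_of_injOn (fun e => (P.proj e.1, P.proj e.2.1, P.proj e.2.2)) ?_
    (fun _ _ => Finset.mem_coe.mpr (Finset.mem_univ _)) ?_ ?_
  · intro e he e' he' hee'
    obtain ⟨hu, hvw⟩ := Prod.mk.inj hee'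
    obtain ⟨hv, hw⟩ := Prod.mk.inj hvw
    obtain ⟨hu, hv, hw⟩ := P.isTriangle_eq_of_proj_eq (Finset.mem_filter.mp he).2
      (Finset.mem_filter.mp he').2 hu hv hw
    exact Prod.ext hu (Prod.ext hv hw)
  · rintro ⟨a, b, d⟩ - hmem
    have hT : ¬ IsTriangle K a b d := fun hT => hmem <| by
      obtain ⟨u, v, w, hlift, rfl, rfl, rfl⟩ := P.exists_isTriangle_lift hT
      exact ⟨(u, v, w), by simpa using hlift, rfl⟩
    rw [o.eq_zero a b d hT, Int.cast_zero, zero_mul]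
  · intro e he
    have hT := (Finset.mem_filter.mp he).2
    rw [P.liftCoeff_of_isTriangle hT, h _ _ _ hT]

theorem evalFund_cup_eq_evalLift (P : CanonicalPolygon K o g D) (σ τ : Cochain1 K) :
    evalFund o (cup σ τ) = P.evalLift (cup (pullback D P.proj σ) (pullback D P.proj τ)) :=
  P.evalFund_eq_evalLift fun u v w h => by
    rw [cup_apply_of_isTriangle _ _ h, cup_apply_of_isTriangle _ _ (P.isTriangle_proj h)]
    simp only [pullback_apply_of_isEdge P.proj _ h.isEdge_left,
      pullback_apply_of_isEdge P.proj _ h.isEdge_right,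
      pullback_apply_of_isEdge P.proj _ h.isEdge_outer]

theorem evalLift_delta1 (P : CanonicalPolygon K o g D) (h : Cochain1 D) :
    P.evalLift (delta1 D h) = ∑ i, ∑ s, ∑ k ∈ Finset.range (P.len i s),
      (h.1 (P.side i s k) (P.side i s (k + 1)) - h.1 (P.opp i s k) (P.opp i s (k + 1))) := by
  have hterm : ∀ u v w, (P.liftCoeff u v w : ℂ) * (delta1 D h).1 u v w =
      P.liftCoeff u v w * (h.1 v w - h.1 u w + h.1 u v) := fun u v w => by
    by_cases hT : IsTriangle D u v w
    · rw [delta1_apply_of_isTriangle h hT]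
    · rw [P.liftCoeff_of_not_isTriangle hT, Int.cast_zero, zero_mul, zero_mul]
  have hboundary : ∀ e : W × W, ∑ w, (P.liftCoeff e.1 e.2 w : ℂ) =
      ∑ i, ∑ s, ∑ k ∈ Finset.range (P.len i s),
        (((if e = (P.side i s k, P.side i s (k + 1)) then 1 else 0) -
            (if e.swap = (P.side i s k, P.side i s (k + 1)) then 1 else 0)) -
          ((if e = (P.opp i s k, P.opp i s (k + 1)) then 1 else 0) -
            (if e.swap = (P.opp i s k, P.opp i s (k + 1)) then 1 else 0))) := fun e => by
    have horiented := congrArg (Int.cast : ℤ → ℂ) (P.oriented e.1 e.2)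
    push_cast at horiented
    simp only [liftCoeff, Int.cast_ite, Int.cast_zero, horiented]
    refine Finset.sum_congr rfl fun i _ => Finset.sum_congr rfl fun s _ =>
      Finset.sum_congr rfl fun k _ => ?_
    rw [← sub_add, Prod.swap]
  simp only [evalLift, hterm]
  rw [sum_alternating_mul (fun u v w => by rw [P.liftCoeff_swap_left, Int.cast_neg])
    (fun u v w => by rw [P.liftCoeff_swap_right, Int.cast_neg]) h.1, ← Fintype.sum_prod_type']
  simp only [hboundary, Finset.mul_sum]
  rw [Finset.sum_comm]
  refine Finset.sum_congr rfl fun i _ => ?_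
  rw [Finset.sum_comm]
  refine Finset.sum_congr rfl fun s _ => ?_
  rw [Finset.sum_comm]
  refine Finset.sum_congr rfl fun k _ => ?_
  simp only [← Finset.mul_sum]
  simp only [mul_sub (h.1 _ _) (_ - _), Finset.sum_sub_distrib, sum_mul_edge_indicator h.2.1]
  ring

/-! ### The bilinear relation for closed cochains -/

theorem period_add (P : CanonicalPolygon K o g D) (σ τ : Cochain1 K) (i : Fin g) (s : Fin 2) :
    P.period (σ + τ) i s = P.period σ i s + P.period τ i s :=
  Finset.sum_add_distrib

theorem period_smul (P : CanonicalPolygon K o g D) (z : ℂ) (σ : Cochain1 K) (i : Fin g)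
    (s : Fin 2) : P.period (z • σ) i s = z * P.period σ i s :=
  (Finset.mul_sum _ _ _).symm

theorem period_conjCochain (P : CanonicalPolygon K o g D) (σ : Cochain1 K) (i : Fin g)
    (s : Fin 2) : P.period (conjCochain σ) i s = conj (P.period σ i s) :=
  (map_sum _ _ _).symm

/-- Riemann's bilinear form `∑ (A_i B_i' - B_i A_i')` on the periods of two cochains. -/
def periodForm (P : CanonicalPolygon K o g D) : Cochain1 K →ₗ[ℂ] Cochain1 K →ₗ[ℂ] ℂ :=
  LinearMap.mk₂ ℂ
    (fun σ τ => ∑ i, (P.periodA σ i * P.periodB τ i - P.periodB σ i * P.periodA τ i))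
    (fun σ σ' τ => by
      simp only [periodA, periodB, period_add, ← Finset.sum_add_distrib]
      exact Finset.sum_congr rfl fun i _ => by ring)
    (fun z σ τ => by
      simp only [periodA, periodB, period_smul, smul_eq_mul, Finset.mul_sum]
      exact Finset.sum_congr rfl fun i _ => by ring)
    (fun σ τ τ' => by
      simp only [periodA, periodB, period_add, ← Finset.sum_add_distrib]
      exact Finset.sum_congr rfl fun i _ => by ring)
    (fun z σ τ => by
      simp only [periodA, periodB, period_smul, smul_eq_mul, Finset.mul_sum]
      exact Finset.sum_congr rfl fun i _ => by ring)

theorem periodForm_apply (P : CanonicalPolygon K o g D) (σ τ : Cochain1 K) :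
    P.periodForm σ τ =
      ∑ i, (P.periodA σ i * P.periodB τ i - P.periodB σ i * P.periodA τ i) := rfl

theorem sum_meanMul_side_sub_opp (P : CanonicalPolygon K o g D) (τ : Cochain1 K) {f : W → ℂ}
    {i : Fin g} {s : Fin 2} {j : ℂ}
    (hj : ∀ k ≤ P.len i s, f (P.opp i s k) - f (P.side i s k) = j) :
    ∑ k ∈ Finset.range (P.len i s),
      ((meanMul f (pullback D P.proj τ)).1 (P.side i s k) (P.side i s (k + 1)) -
        (meanMul f (pullback D P.proj τ)).1 (P.opp i s k) (P.opp i s (k + 1))) =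
      -(j * P.period τ i s) := by
  rw [period, Finset.mul_sum, ← Finset.sum_neg_distrib]
  refine Finset.sum_congr rfl fun k hk => ?_
  have hk' : k < P.len i s := Finset.mem_range.mp hk
  rw [meanMul_apply, meanMul_apply, pullback_apply_of_isEdge _ _ (P.side_edge i s k hk'),
    pullback_apply_of_isEdge _ _ (P.opp_edge i s k hk'), ← P.proj_side_eq_proj_opp hk',
    ← P.proj_side_eq_proj_opp hk'.le]
  linear_combination (-(1 / 2) * τ.1 (P.proj (P.side i s k)) (P.proj (P.side i s (k + 1)))) *
    (hj k hk'.le + hj (k + 1) hk')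

theorem evalFund_cup (P : CanonicalPolygon K o g D) {σ τ : Cochain1 K}
    (hσ : delta1 K σ = 0) (hτ : delta1 K τ = 0) :
    evalFund o (cup σ τ) = P.periodForm σ τ := by
  obtain ⟨f, hf⟩ := P.exists_isPotential hσ
  have hcup : cup (pullback D P.proj σ) (pullback D P.proj τ) =
      delta1 D (meanMul f (pullback D P.proj τ)) := by
    rw [hf, cup_delta0 f (delta1_pullback P.proj_mem hτ)]
  rw [P.evalFund_cup_eq_evalLift, hcup, P.evalLift_delta1, periodForm_apply]
  refine Finset.sum_congr rfl fun i _ => ?_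
  rw [Fin.sum_univ_two, P.sum_meanMul_side_sub_opp τ fun k hk => hf.jump_a i hk,
    P.sum_meanMul_side_sub_opp τ fun k hk => hf.jump_b i hk, periodA, periodA, periodB, periodB]
  ring

/-! ### Periods classify closed cochains modulo exact ones -/

theorem exists_eq_on_lt_len {α : Type*} (P : CanonicalPolygon K o g D)
    (S T : Fin g → Fin 2 → ℕ → α) :
    ∃ f : W → α, (∀ i s k, k < P.len i s → f (P.side i s k) = S i s k) ∧
      ∀ i s k, k < P.len i s → f (P.opp i s (k + 1)) = T i s (k + 1) := by
  let Index := {x : Fin g × Fin 2 × ℕ // x.2.2 < P.len x.1 x.2.1}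
  let vertex : Index ⊕ Index → W :=
    Sum.elim (fun x => P.side x.1.1 x.1.2.1 x.1.2.2) (fun x => P.opp x.1.1 x.1.2.1 (x.1.2.2 + 1))
  let value : Index ⊕ Index → α :=
    Sum.elim (fun x => S x.1.1 x.1.2.1 x.1.2.2) (fun x => T x.1.1 x.1.2.1 (x.1.2.2 + 1))
  have hvertex : Function.Injective vertex := by
    refine Function.Injective.sumElim (fun x y h => ?_) (fun x y h => ?_) fun x y =>
      P.side_ne_opp _ _ _ _ _ _ x.2 y.2
    · obtain ⟨hi, hs, hk⟩ := P.side_inj _ _ _ _ _ _ x.2 y.2 h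
      exact Subtype.ext (Prod.ext hi (Prod.ext hs hk))
    · obtain ⟨hi, hs, hk⟩ := P.opp_inj _ _ _ _ _ _ x.2 y.2 h
      exact Subtype.ext (Prod.ext hi (Prod.ext hs hk))
  exact ⟨Function.extend vertex value fun _ => S 0 0 0,
    fun i s k hk => hvertex.extend_apply value _ (.inl ⟨(i, s, k), hk⟩),
    fun i s k hk => hvertex.extend_apply value _ (.inr ⟨(i, s, k), hk⟩)⟩

theorem exists_boundary_extension {α : Type*} (P : CanonicalPolygon K o g D)
    {S T : Fin g → Fin 2 → ℕ → α} (hab : ∀ i, S i 0 (P.len i 0) = S i 1 0)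
    (hba' : ∀ i, S i 1 (P.len i 1) = T i 0 (P.len i 0))
    (ha'b' : ∀ i, T i 0 0 = T i 1 (P.len i 1)) (hb'a : ∀ i, T i 1 0 = S (i + 1) 0 0) :
    ∃ f : W → α, ∀ i s k, k ≤ P.len i s →
      f (P.side i s k) = S i s k ∧ f (P.opp i s k) = T i s k := by
  obtain ⟨f, hside, hopp⟩ := P.exists_eq_on_lt_len S T
  have hopp_pos : ∀ i s k, 0 < k → k ≤ P.len i s → f (P.opp i s k) = T i s k := by
    intro i s k hpos hk
    obtain ⟨m, rfl⟩ := Nat.exists_eq_succ_of_ne_zero hpos.ne'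
    exact hopp i s m hk
  have hopp_len : ∀ i s, f (P.opp i s (P.len i s)) = T i s (P.len i s) := fun i s =>
    hopp_pos i s _ (P.len_pos i s) le_rfl
  refine ⟨f, fun i s k hk => ⟨?_, ?_⟩⟩
  · rcases hk.lt_or_eq with hlt | rfl
    · exact hside i s k hlt
    · match s with
      | 0 => rw [P.corner_a_b, hside i 1 0 (P.len_pos i 1), hab]
      | 1 => rw [P.corner_b_a', hopp_len i 0, hba']
  · rcases k.eq_zero_or_pos with rfl | hpos
    · match s with
      | 0 => rw [P.corner_a'_b', hopp_len i 1, ha'b']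
      | 1 => rw [P.corner_b'_a, hside (i + 1) 0 0 (P.len_pos _ 0), hb'a]
    · exact hopp_pos i s k hpos hk

/-- Interpolate linearly along the sides: `f` climbs by `A i` along `a_i` and by `B i` along `b_i`,
as the potential of a cochain with these periods would. -/
theorem exists_jumps (P : CanonicalPolygon K o g D) (A B : Fin g → ℂ) :
    ∃ f : W → ℂ, ∀ i s k, k ≤ P.len i s →
      f (P.opp i s k) - f (P.side i s k) = ![B i, -A i] s := by
  have hlen : ∀ i s, (P.len i s : ℂ) ≠ 0 := fun i s => Nat.cast_ne_zero.mpr (P.len_pos i s).ne'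
  let S : Fin g → Fin 2 → ℕ → ℂ := fun i s k =>
    ![0, A i] s + k / P.len i s * ![A i, B i] s
  obtain ⟨f, hf⟩ := P.exists_boundary_extension (S := S)
    (T := fun i s k => S i s k + ![B i, -A i] s)
    (fun i => by simp [S, hlen]) (fun i => by simp [S, hlen, add_comm])
    (fun i => by simp [S, hlen]) (fun i => by simp [S])
  refine ⟨f, fun i s k hk => ?_⟩
  rw [(hf i s k hk).1, (hf i s k hk).2, add_sub_cancel_left]

theorem sub_eq_sub_of_jump_eq (P : CanonicalPolygon K o g D) {f : W → ℂ} {j : ℂ}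
    {i : Fin g} {s : Fin 2} {k : ℕ} (hk : k < P.len i s)
    (hstart : f (P.opp i s k) - f (P.side i s k) = j)
    (hend : f (P.opp i s (k + 1)) - f (P.side i s (k + 1)) = j)
    {u v u' v' : W} (he : IsEdge D u v) (hu : P.proj u = P.proj u') (hv : P.proj v = P.proj v')
    (hside : ({u, v} : Finset W) = {P.side i s k, P.side i s (k + 1)})
    (hopp : ({u', v'} : Finset W) = {P.opp i s k, P.opp i s (k + 1)}) :
    f v - f u = f v' - f u' := by
  have hne := (P.isEdge_proj he).1
  have hproj_start := P.proj_side_eq_proj_opp hk.le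
  have hproj_end := P.proj_side_eq_proj_opp (Nat.succ_le_of_lt hk)
  rw [← Finset.coe_inj, Finset.coe_pair, Finset.coe_pair, Set.pair_eq_pair_iff] at hside hopp
  rcases hside with ⟨rfl, rfl⟩ | ⟨rfl, rfl⟩ <;> rcases hopp with ⟨rfl, rfl⟩ | ⟨rfl, rfl⟩
  · linear_combination hstart - hend
  · exact absurd (hu.trans hproj_end.symm) hne
  · exact absurd (hu.trans hproj_start.symm) hne
  · linear_combination hend - hstart

theorem exists_closed_of_jumps (P : CanonicalPolygon K o g D) {f : W → ℂ} {c : Fin g → Fin 2 → ℂ}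
    (hf : ∀ i s k, k ≤ P.len i s → f (P.opp i s k) - f (P.side i s k) = c i s) :
    ∃ τ : Cochain1 K, delta1 K τ = 0 ∧ P.IsPotential τ f := by
  have hglue : ∀ u v u' v', IsEdge D u v → IsEdge D u' v' → P.proj u = P.proj u' →
      P.proj v = P.proj v' → f v - f u = f v' - f u' := by
    intro u v u' v' he he' hu hv
    rcases P.glue_edge u v u' v' he he' hu hv with
      ⟨rfl, rfl⟩ | ⟨i, s, k, hk, ⟨hside, hopp⟩ | ⟨hopp, hside⟩⟩
    · rfl
    · exact P.sub_eq_sub_of_jump_eq hk (hf i s k hk.le) (hf i s (k + 1) hk) he hu hv hside hopp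
    · exact (P.sub_eq_sub_of_jump_eq hk (hf i s k hk.le) (hf i s (k + 1) hk) he' hu.symm hv.symm
        hside hopp).symm
  obtain ⟨τ, hτ⟩ := P.exists_pullback_eq (τ := delta0 D f) fun u v u' v' he he' hu hv => by
    rw [delta0_apply_of_isEdge f he, delta0_apply_of_isEdge f he', hglue u v u' v' he he' hu hv]
  exact ⟨τ, P.delta1_eq_zero_of_pullback (by rw [hτ, delta1_delta0]), hτ⟩

theorem exists_closed_of_periods (P : CanonicalPolygon K o g D) (A B : Fin g → ℂ) :
    ∃ τ : Cochain1 K, delta1 K τ = 0 ∧ P.periodA τ = A ∧ P.periodB τ = B := by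
  obtain ⟨f, hf⟩ := P.exists_jumps A B
  obtain ⟨τ, hτ, hfτ⟩ := P.exists_closed_of_jumps hf
  refine ⟨τ, hτ, funext fun i => ?_, funext fun i => ?_⟩
  · exact neg_inj.mp ((hfτ.jump_b i (Nat.zero_le _)).symm.trans (hf i 1 0 (Nat.zero_le _)))
  · exact (hfτ.jump_a i (Nat.zero_le _)).symm.trans (hf i 0 0 (Nat.zero_le _))

theorem exists_eq_delta0_of_period_eq_zero (P : CanonicalPolygon K o g D) {σ : Cochain1 K}
    (hσ : delta1 K σ = 0) (hA : P.periodA σ = 0) (hB : P.periodB σ = 0) :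
    ∃ F : V → ℂ, σ = delta0 K F := by
  obtain ⟨f, hf⟩ := P.exists_isPotential hσ
  have hfactors : Function.FactorsThrough f P.proj := by
    intro w w' h
    induction (P.glue_vertex w w').mp h with
    | rel x y hpair =>
      obtain ⟨i, s, k, hk, rfl, rfl⟩ := hpair
      match s with
      | 0 => exact (sub_eq_zero.mp ((hf.jump_a i hk).trans (congrFun hB i))).symm
      | 1 => exact (sub_eq_zero.mp ((hf.jump_b i hk).trans (by simp [hA]))).symm
    | refl x => rfl
    | symm x y _ ih => exact (ih h.symm).symm
    | trans x y z hxy hyz ihxy ihyz =>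
      exact (ihxy ((P.glue_vertex x y).mpr hxy)).trans (ihyz ((P.glue_vertex y z).mpr hyz))
  refine ⟨Function.extend P.proj f 0, eq_delta0_iff.mpr fun a b h => ?_⟩
  obtain ⟨u, v, he, rfl, rfl⟩ := P.exists_isEdge_lift h
  rw [hf.apply_proj he, hfactors.extend_apply, hfactors.extend_apply]

theorem isPotential_delta0 (P : CanonicalPolygon K o g D) (F : V → ℂ) :
    P.IsPotential (delta0 K F) (F ∘ P.proj) := pullback_delta0 P.proj_mem F

theorem periodA_delta0 (P : CanonicalPolygon K o g D) (F : V → ℂ) :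
    P.periodA (delta0 K F) = 0 := by
  funext i
  have hjump := (P.isPotential_delta0 F).jump_b i (Nat.zero_le _)
  rw [Function.comp_apply, Function.comp_apply, P.proj_side_eq_proj_opp (Nat.zero_le _),
    sub_self] at hjump
  exact neg_eq_zero.mp hjump.symm

theorem periodB_delta0 (P : CanonicalPolygon K o g D) (F : V → ℂ) :
    P.periodB (delta0 K F) = 0 := by
  funext i
  have hjump := (P.isPotential_delta0 F).jump_a i (Nat.zero_le _)
  rw [Function.comp_apply, Function.comp_apply, P.proj_side_eq_proj_opp (Nat.zero_le _),
    sub_self] at hjump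
  exact hjump.symm

end CanonicalPolygon

/-! ### Harmonic cochains -/

theorem exists_orthogonal_decomposition {𝕜 E : Type*} [RCLike 𝕜] [AddCommGroup E] [Module 𝕜 E]
    [FiniteDimensional 𝕜 E] (ip : InnerProductSpace.Core 𝕜 E) (S : Submodule 𝕜 E) (x : E) :
    ∃ y ∈ S, ∃ z, (∀ u ∈ S, ip.inner u z = 0) ∧ x = y + z := by
  let _ : NormedAddCommGroup E := ip.toNormedAddCommGroup
  let _ : InnerProductSpace 𝕜 E := InnerProductSpace.ofCore ip.toCore
  obtain ⟨y, hy, z, hz, h⟩ := S.exists_add_mem_mem_orthogonal x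
  exact ⟨y, hy, z, fun u hu => (Submodule.mem_orthogonal S z).mp hz u hu, h⟩

section Conj

variable {V : Type*} [DecidableEq V] {K : AbstractSimplicialComplex V}

theorem conjCochain_conjCochain (σ : Cochain1 K) : conjCochain (conjCochain σ) = σ := by
  ext u v
  exact Complex.conj_conj _

theorem conjCochain_add (σ τ : Cochain1 K) :
    conjCochain (σ + τ) = conjCochain σ + conjCochain τ := by
  ext u v
  exact map_add _ _ _

theorem delta1_conjCochain {σ : Cochain1 K} (hσ : delta1 K σ = 0) :
    delta1 K (conjCochain σ) = 0 := by
  rw [delta1_eq_zero_iff] at hσ ⊢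
  intro u v w h
  simp only [conjCochain, ← map_add, hσ u v w h]

theorem conjCochain_delta0 (f : V → ℂ) :
    conjCochain (delta0 K f) = delta0 K (fun v => conj (f v)) := by
  refine eq_delta0_iff.mpr fun u v h => ?_
  rw [← map_sub, ← delta0_apply_of_isEdge f h]
  rfl

end Conj

section Herm

variable {V : Type*} [DecidableEq V] {K : AbstractSimplicialComplex V}
  (ip : InnerProductSpace.Core ℂ (Cochain1 K))

theorem conj_herm (a b : Cochain1 K) : conj (herm ip a b) = herm ip b a :=
  ip.conj_inner_symm a b

theorem herm_add_right (a b c : Cochain1 K) : herm ip a (b + c) = herm ip a b + herm ip a c :=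
  ip.add_left b c a

theorem herm_smul_right (z : ℂ) (a b : Cochain1 K) : herm ip a (z • b) = conj z * herm ip a b :=
  ip.smul_left b a z

theorem herm_smul_left (z : ℂ) (a b : Cochain1 K) : herm ip (z • a) b = z * herm ip a b := by
  rw [← conj_herm, herm_smul_right, map_mul, Complex.conj_conj, conj_herm]

theorem herm_self_nonneg (a : Cochain1 K) : 0 ≤ herm ip a a :=
  Complex.nonneg_iff.mpr
    ⟨ip.re_inner_nonneg a, (Complex.conj_eq_iff_im.mp (conj_herm ip a a)).symm⟩

theorem hermNorm_sq (a : Cochain1 K) : ((hermNorm ip a ^ 2 : ℝ) : ℂ) = herm ip a a := by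
  rw [hermNorm, Real.sq_sqrt (Complex.nonneg_iff.mp (herm_self_nonneg ip a)).1]
  exact Complex.conj_eq_iff_re.mp (conj_herm ip a a)

theorem exists_harmonic_decomposition [Finite V] {τ : Cochain1 K} (hτ : delta1 K τ = 0) :
    ∃ f : V → ℂ, ∃ h ∈ harmonic ip, τ = delta0 K f + h := by
  obtain ⟨_, ⟨f, rfl⟩, h, horth, rfl⟩ :=
    exists_orthogonal_decomposition ip (LinearMap.range (delta0 K)) τ
  rw [map_add, delta1_delta0, zero_add] at hτ
  exact ⟨f, h, ⟨hτ, fun F => horth _ ⟨F, rfl⟩⟩, rfl⟩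

variable {ip}

theorem IsComplexification.conjCochain_mem_harmonic (hip : IsComplexification ip)
    {σ : Cochain1 K} (hσ : σ ∈ harmonic ip) : conjCochain σ ∈ harmonic ip := by
  refine ⟨delta1_conjCochain hσ.1, fun f => ?_⟩
  have h := hip σ (conjCochain (delta0 K f))
  rwa [conjCochain_conjCochain, conjCochain_delta0, hσ.2, map_zero] at h

theorem IsComplexification.herm_conjCochain_comm (hip : IsComplexification ip)
    (σ τ : Cochain1 K) : herm ip σ (conjCochain τ) = herm ip τ (conjCochain σ) := by
  have h := hip (conjCochain τ) σ
  rw [conjCochain_conjCochain, conj_herm] at h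
  exact h.symm

theorem holomorphic_le_harmonic [Fintype V] (o : SurfaceOrientation K) :
    holomorphic o ip ≤ harmonic ip :=
  Submodule.span_le.mpr fun _ h => h.1

end Herm

namespace CanonicalPolygon

variable {V W : Type*} [Fintype V] [DecidableEq V] [Fintype W] [DecidableEq W]
  {K : AbstractSimplicialComplex V} {o : SurfaceOrientation K} {g : ℕ} [NeZero g]
  {D : AbstractSimplicialComplex W} {ip : InnerProductSpace.Core ℂ (Cochain1 K)}

/-! ### Poincaré duality -/

theorem periodForm_swap (P : CanonicalPolygon K o g D) (σ τ : Cochain1 K) :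
    P.periodForm τ σ = -P.periodForm σ τ := by
  rw [periodForm_apply, periodForm_apply, ← Finset.sum_neg_distrib]
  exact Finset.sum_congr rfl fun i _ => by ring

theorem periodForm_conjCochain (P : CanonicalPolygon K o g D) (σ τ : Cochain1 K) :
    P.periodForm (conjCochain σ) (conjCochain τ) = conj (P.periodForm σ τ) := by
  simp only [periodForm_apply, periodA, periodB, period_conjCochain, map_sum, map_sub, map_mul]

theorem periodForm_delta0_right (P : CanonicalPolygon K o g D) (σ : Cochain1 K) (F : V → ℂ) :
    P.periodForm σ (delta0 K F) = 0 := by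
  simp [periodForm_apply, periodA_delta0, periodB_delta0]

theorem exists_eq_delta0_of_periodForm_eq_zero (P : CanonicalPolygon K o g D) {σ : Cochain1 K}
    (hσ : delta1 K σ = 0) (h : ∀ τ, delta1 K τ = 0 → P.periodForm σ τ = 0) :
    ∃ F : V → ℂ, σ = delta0 K F := by
  refine P.exists_eq_delta0_of_period_eq_zero hσ (funext fun i => ?_) (funext fun i => ?_)
  · obtain ⟨τ, hτ, hA, hB⟩ := P.exists_closed_of_periods 0 (Pi.single i 1)
    simpa [periodForm_apply, hA, hB, Pi.single_apply] using h τ hτ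
  · obtain ⟨τ, hτ, hA, hB⟩ := P.exists_closed_of_periods (Pi.single i 1) 0
    simpa [periodForm_apply, hA, hB, Pi.single_apply] using h τ hτ

theorem herm_harmonicStar (P : CanonicalPolygon K o g D) {σ τ : Cochain1 K}
    (hσ : σ ∈ harmonic ip) (hτ : τ ∈ harmonic ip) :
    herm ip (harmonicStar o ip σ) τ = P.periodForm σ (conjCochain τ) := by
  rw [harmonicStar, herm_harmonicPart ip _ hτ, star_spec,
    P.evalFund_cup hσ.1 (delta1_conjCochain hτ.1)]

theorem mul_herm_eq_periodForm (P : CanonicalPolygon K o g D) {σ τ : Cochain1 K}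
    (hσ : σ ∈ harmonic ip) (hτ : τ ∈ harmonic ip) {z : ℂ} (hz : harmonicStar o ip σ = z • σ) :
    z * herm ip σ τ = P.periodForm σ (conjCochain τ) := by
  rw [← P.herm_harmonicStar hσ hτ, hz, herm_smul_left]

theorem eq_zero_of_harmonicStar_eq_zero (P : CanonicalPolygon K o g D) {σ : Cochain1 K}
    (hσ : σ ∈ harmonic ip) (hstar : harmonicStar o ip σ = 0) : σ = 0 := by
  have hform : ∀ τ, delta1 K τ = 0 → P.periodForm σ τ = 0 := by
    intro τ hτ
    obtain ⟨f, ρ, hρ, hdecomp⟩ := exists_harmonic_decomposition ip (delta1_conjCochain hτ)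
    have hσρ := P.mul_herm_eq_periodForm hσ hρ (hstar.trans (zero_smul ℂ σ).symm)
    rw [← conjCochain_conjCochain τ, hdecomp, conjCochain_add, conjCochain_delta0, map_add,
      periodForm_delta0_right, ← hσρ, zero_mul, add_zero]
  obtain ⟨F, rfl⟩ := P.exists_eq_delta0_of_periodForm_eq_zero hσ.1 hform
  exact ip.definite _ (hσ.2 F)

/-! ### Holomorphic cochains -/

theorem herm_eq_zero_of_ne (P : CanonicalPolygon K o g D) {σ τ : Cochain1 K}
    (hσ : σ ∈ harmonic ip) (hτ : τ ∈ harmonic ip) {a b : ℝ}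
    (ha : harmonicStar o ip σ = (-Complex.I * a) • σ)
    (hb : harmonicStar o ip τ = (-Complex.I * b) • τ) (hab : a ≠ b) : herm ip σ τ = 0 := by
  have hστ := P.mul_herm_eq_periodForm hσ hτ ha
  have hτσ := congrArg conj (P.mul_herm_eq_periodForm hτ hσ hb)
  rw [← P.periodForm_conjCochain, conjCochain_conjCochain, P.periodForm_swap, ← hστ, map_mul,
    conj_herm, map_mul, map_neg, Complex.conj_I, Complex.conj_ofReal] at hτσ
  have hmul : Complex.I * ((a - b : ℝ) : ℂ) * herm ip σ τ = 0 := by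
    push_cast
    linear_combination -hτσ
  exact (mul_eq_zero.mp hmul).resolve_left
    (mul_ne_zero Complex.I_ne_zero (Complex.ofReal_ne_zero.mpr (sub_ne_zero.mpr hab)))

/-- Both `-i a ⟨σ, τ̄⟩` and `-(-i b ⟨σ, τ̄⟩)` equal the period form, hence `(a + b) ⟨σ, τ̄⟩ = 0`. -/
theorem periodForm_eq_zero_of_harmonicStar_eq (P : CanonicalPolygon K o g D)
    (hip : IsComplexification ip) {σ τ : Cochain1 K} (hσ : σ ∈ harmonic ip)
    (hτ : τ ∈ harmonic ip) {a b : ℝ} (ha : 0 ≤ a) (hb : 0 ≤ b)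
    (hσa : harmonicStar o ip σ = (-Complex.I * a) • σ)
    (hτb : harmonicStar o ip τ = (-Complex.I * b) • τ) : P.periodForm σ τ = 0 := by
  have hστ := P.mul_herm_eq_periodForm hσ (hip.conjCochain_mem_harmonic hτ) hσa
  have hτσ := P.mul_herm_eq_periodForm hτ (hip.conjCochain_mem_harmonic hσ) hτb
  rw [conjCochain_conjCochain] at hστ hτσ
  rw [P.periodForm_swap, ← hip.herm_conjCochain_comm] at hτσ
  have hmul : ((a + b : ℝ) : ℂ) * herm ip σ (conjCochain τ) = 0 := by
    refine (mul_eq_zero.mp ?_).resolve_left Complex.I_ne_zero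
    push_cast
    linear_combination -hστ - hτσ
  rcases mul_eq_zero.mp hmul with hab | hherm
  · have ha0 : a = 0 := by linarith [Complex.ofReal_eq_zero.mp hab]
    rw [← hστ, ha0, Complex.ofReal_zero, mul_zero, zero_mul]
  · rw [← hστ, hherm, mul_zero]

theorem periodForm_eq_zero_of_mem_holomorphic (P : CanonicalPolygon K o g D)
    (hip : IsComplexification ip) {σ τ : Cochain1 K} (hσ : σ ∈ holomorphic o ip)
    (hτ : τ ∈ holomorphic o ip) : P.periodForm σ τ = 0 := by
  induction hσ, hτ using Submodule.span_induction₂ with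
  | mem_mem σ τ hσ hτ =>
    obtain ⟨hσ, a, ha, hσa⟩ := hσ
    obtain ⟨hτ, b, hb, hτb⟩ := hτ
    exact P.periodForm_eq_zero_of_harmonicStar_eq hip hσ hτ ha hb hσa hτb
  | zero_left τ _ => rw [map_zero, LinearMap.zero_apply]
  | zero_right σ _ => rw [map_zero]
  | add_left σ σ' τ _ _ _ h h' => rw [map_add, LinearMap.add_apply, h, h', add_zero]
  | add_right σ τ τ' _ _ _ h h' => rw [map_add, h, h', add_zero]
  | smul_left z σ τ _ _ h => rw [map_smul, LinearMap.smul_apply, h, smul_zero]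
  | smul_right z σ τ _ _ h => rw [map_smul, h, smul_zero]

/-- An eigencochain with `a < 0` would be orthogonal to all generators of the holomorphic
cochains, hence to itself; `a = 0` is excluded by Poincaré duality. -/
theorem pos_of_mem_holomorphic (P : CanonicalPolygon K o g D) {σ : Cochain1 K}
    (hσ : σ ∈ holomorphic o ip) {a : ℝ} (ha : harmonicStar o ip σ = (-Complex.I * a) • σ)
    (hσ0 : σ ≠ 0) : 0 < a := by
  have hσ_harmonic := holomorphic_le_harmonic o hσ
  by_contra! hnonpos
  rcases hnonpos.eq_or_lt with rfl | hneg
  · exact hσ0 (P.eq_zero_of_harmonicStar_eq_zero hσ_harmonic (by simpa using ha))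
  · have horth : ∀ τ ∈ holomorphic o ip, herm ip σ τ = 0 := by
      intro τ hτ
      induction hτ using Submodule.span_induction with
      | mem τ hτ =>
        obtain ⟨hτ, b, hb, hτb⟩ := hτ
        exact P.herm_eq_zero_of_ne hσ_harmonic hτ ha hτb (hneg.trans_le hb).ne
      | zero => simpa using herm_smul_right ip 0 σ 0
      | add τ τ' _ _ h h' => rw [herm_add_right, h, h', add_zero]
      | smul z τ _ h => rw [herm_smul_right, h, mul_zero]
    exact hσ0 (ip.definite σ (horth σ hσ))

theorem herm_self_eq_periods (P : CanonicalPolygon K o g D) {σ : Cochain1 K}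
    (hσ : σ ∈ harmonic ip) {a : ℂ} (ha : harmonicStar o ip σ = (-Complex.I * a) • σ)
    (ha0 : a ≠ 0) :
    herm ip σ σ = Complex.I / a *
      ∑ i, (P.periodA σ i * conj (P.periodB σ i) - P.periodB σ i * conj (P.periodA σ i)) := by
  have hperiods : -Complex.I * a * herm ip σ σ =
      ∑ i, (P.periodA σ i * conj (P.periodB σ i) - P.periodB σ i * conj (P.periodA σ i)) := by
    simpa only [periodForm_apply, periodA, periodB, period_conjCochain] using
      P.mul_herm_eq_periodForm hσ hσ ha
  rw [← hperiods]
  field_simp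
  linear_combination herm ip σ σ * Complex.I_sq

end CanonicalPolygon

end CombSurface

end

theorem mainTheorem9 {V W : Type*} [Fintype V] [DecidableEq V] [Fintype W] [DecidableEq W]
    (K : AbstractSimplicialComplex V) (o : CombSurface.SurfaceOrientation K)
    (g : ℕ) [NeZero g] (D : AbstractSimplicialComplex W)
    (P : CombSurface.CanonicalPolygon K o g D)
    (ip : InnerProductSpace.Core ℂ (CombSurface.Cochain1 K)) :
    (CombSurface.IsComplexification ip →
      ∀ σ ∈ CombSurface.holomorphic o ip, ∀ σ' ∈ CombSurface.holomorphic o ip,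
        (∀ lam : ℝ, CombSurface.harmonicStar o ip σ = (-Complex.I * lam) • σ →
          -Complex.I * lam * CombSurface.herm ip σ (CombSurface.conjCochain σ') =
            ∑ i, (P.periodA σ i * P.periodB σ' i - P.periodB σ i * P.periodA σ' i)) ∧
        ∑ i, (P.periodA σ i * P.periodB σ' i - P.periodB σ i * P.periodA σ' i) = 0) ∧
    ∀ σ ∈ CombSurface.holomorphic o ip, ∀ lam : ℝ,
      CombSurface.harmonicStar o ip σ = (-Complex.I * lam) • σ →
        (σ ≠ 0 → 0 < lam) ∧
        (0 < lam →
          ((CombSurface.hermNorm ip σ ^ 2 : ℝ) : ℂ) = CombSurface.herm ip σ σ ∧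
          CombSurface.herm ip σ σ = Complex.I / lam *
            ∑ i, (P.periodA σ i * conj (P.periodB σ i) - P.periodB σ i * conj (P.periodA σ i)) ∧
          0 ≤ Complex.I / lam *
            ∑ i, (P.periodA σ i * conj (P.periodB σ i) - P.periodB σ i * conj (P.periodA σ i))) := by
  refine ⟨fun hip σ hσ σ' hσ' =>
      ⟨fun lam hlam => ?_, P.periodForm_eq_zero_of_mem_holomorphic hip hσ hσ'⟩,
    fun σ hσ lam hlam => ⟨P.pos_of_mem_holomorphic hσ hlam, fun hpos => ?_⟩⟩
  · have hconj := hip.conjCochain_mem_harmonic (CombSurface.holomorphic_le_harmonic o hσ')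
    rw [P.mul_herm_eq_periodForm (CombSurface.holomorphic_le_harmonic o hσ) hconj hlam,
      CombSurface.conjCochain_conjCochain, P.periodForm_apply]
  · have hperiods := P.herm_self_eq_periods (CombSurface.holomorphic_le_harmonic o hσ) hlam
      (Complex.ofReal_ne_zero.mpr hpos.ne')
    exact ⟨CombSurface.hermNorm_sq ip σ, hperiods, hperiods ▸ CombSurface.herm_self_nonneg ip σ⟩
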